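/- Let $p > 5$ be a prime, let $k \ge 0$ be an integer, and let $\mathbb{F}_q$ be a field with $q = p^{2^k}$ elements. Call a polynomial $P \in \mathbb{F}_q[X]$ planar over $\mathbb{F}_q$ if, for every non-zero $\alpha \in \mathbb{F}_q$, the map $x \mapsto P(x+\alpha) - P(x) - P(\alpha)$ is a permutation of $\mathbb{F}_q$. Then, for every integer $d \ge 0$, the monomial $X^d$ is planar over $\mathbb{F}_q$ if and only if $d \equiv 2p^i \pmod{p^{2^k} - 1}$ for some integer $i \ge 0$. -/

import Mathlib

/-- A function `F` on a field `K` is planar if `x ↦ F (x + α) - F x - F α` is a permutation of `K`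
for every nonzero `α`. -/
def IsPlanarFunction {K : Type*} [Field K] (F : K → K) : Prop :=
  ∀ α : K, α ≠ 0 → Function.Bijective (fun x : K => F (x + α) - F x - F α)

/-- A polynomial over `K` is planar if its evaluation map is a planar function. -/
def IsPlanarPolynomial {K : Type*} [Field K] (P : Polynomial K) : Prop :=
  IsPlanarFunction (fun x : K => P.eval x)

/-! If d ≡ 2p^i, then x^d is the square of a Frobenius power, and the difference map is 2 α^(p^i)
x^(p^i), which is injective because p is odd.

For the other direction let q = p^N. Planarity gives every Weil sum S = ∑ ψ(b x^d + c x) with b ≠ 0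
the property S · S̄ = q. As p is totally ramified in the p-th cyclotomic ring, with prime π = ζ - 1,
S has half the π-adic valuation of q. Since ψ - 1 is π times the trace modulo π², products of
factors ψ - 1 turn this divisibility into vanishing power sums over the field. Hence q - 1 never
divides de + l when e and l are sums of c₁ and c₂ powers of p with 0 < c₁ + c₂ < N(p - 1)/2
(`not_dvd_of_isPlanarFunction`).

Then induct on k. Over the prime field a division with remainder excludes all residues of d but 2
and (p + 1)/2, and the latter fails by explicit collisions. For the step from Q = p^n to Q²,
planarity descends to the subfield, so up to a power of p the exponent is 2 modulo Q - 1, that is (1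
+ Q) + κ(1 - Q). Digit constructions of pairs e, l of small weight leave only κ ≡ 0, ±1 modulo Q + 1
(`WeightCondition.dvd`). The values 1 and -1 give the exponents 2 and 2Q; the value 0 gives the
norm, whose fibres are too large for a planar monomial. -/

section WeightCondition

/-! ### The totally ramified prime of the cyclotomic ring -/

open Finset

/-- In the ring of integers of the `p`-th cyclotomic field there is a primitive `p`-th root of
unity `ζ` such that `ζ - 1` is a prime element totally ramified over `p`, and there is an
automorphism inverting `ζ`. -/
theorem exists_cyclotomic_ring_of_field (p : ℕ) [hp : Fact p.Prime] (L : Type) [Field L]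
    [NumberField L] [IsCyclotomicExtension {p} ℚ L] :
    ∃ (R : Type) (_ : CommRing R) (_ : IsDomain R) (ζ : R) (σ : R ≃+* R),
      IsPrimitiveRoot ζ p ∧ σ ζ * ζ = 1 ∧ Prime (ζ - 1) ∧
      Associated ((ζ - 1) ^ (p - 1)) (p : R) ∧ ∀ m : ℕ, ζ - 1 ∣ (m : R) ↔ p ∣ m := by
  have : NeZero p := ⟨hp.out.ne_zero⟩
  have hζ : IsPrimitiveRoot (IsCyclotomicExtension.zeta p ℚ L) p :=
    IsCyclotomicExtension.zeta_spec p ℚ L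
  have hirr := Polynomial.cyclotomic.irreducible_rat hp.out.pos
  let τ := IsCyclotomicExtension.fromZetaAut (L := L) hζ.inv hirr
  refine ⟨NumberField.RingOfIntegers L, inferInstance, inferInstance, hζ.toInteger,
    NumberField.RingOfIntegers.mapRingEquiv τ.toRingEquiv, hζ.toInteger_isPrimitiveRoot, ?_,
    hζ.zeta_sub_one_prime',
    IsCyclotomicExtension.Rat.associated_zeta_sub_one_pow_prime p hζ, fun m => ?_⟩
  · apply NumberField.RingOfIntegers.ext
    have h1 : τ (IsCyclotomicExtension.zeta p ℚ L) = (IsCyclotomicExtension.zeta p ℚ L)⁻¹ :=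
      IsCyclotomicExtension.fromZetaAut_spec hζ.inv hirr
    have h2 : IsCyclotomicExtension.zeta p ℚ L ≠ 0 := hζ.ne_zero hp.out.ne_zero
    change τ (IsCyclotomicExtension.zeta p ℚ L) * IsCyclotomicExtension.zeta p ℚ L = 1
    rw [h1, inv_mul_cancel₀ h2]
  · have := IsCyclotomicExtension.Rat.zeta_sub_one_dvd_intCast_iff' p hζ (n := (m : ℤ))
    rw [Int.natCast_dvd_natCast] at this
    simpa using this

theorem exists_cyclotomic_ring (p : ℕ) [hp : Fact p.Prime] :
    ∃ (R : Type) (_ : CommRing R) (_ : IsDomain R) (ζ : R) (σ : R ≃+* R),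
      IsPrimitiveRoot ζ p ∧ σ ζ * ζ = 1 ∧ Prime (ζ - 1) ∧
      Associated ((ζ - 1) ^ (p - 1)) (p : R) ∧ ∀ m : ℕ, ζ - 1 ∣ (m : R) ↔ p ∣ m := by
  have : NeZero p := ⟨hp.out.ne_zero⟩
  have : NeZero (p : ℚ) := ⟨Nat.cast_ne_zero.2 hp.out.ne_zero⟩
  have : @IsCyclotomicExtension {p} ℚ (CyclotomicField p ℚ) _ _ DivisionRing.toRatAlgebra := by
    -- The two ℚ-algebra structures on the field are equal but not syntactically the same.
    rw [Subsingleton.elim (DivisionRing.toRatAlgebra (R := CyclotomicField p ℚ))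
      (CyclotomicField.algebra p ℚ)]
    exact CyclotomicField.isCyclotomicExtension p ℚ
  exact exists_cyclotomic_ring_of_field p (CyclotomicField p ℚ)

/-! ### Valuation of the Weil sums -/

section Valuation

variable {R : Type*} [CommRing R] [IsDomain R]

/-- If `W * σ W = p ^ N` and `σ` fixes the totally ramified prime `π` over `p` up to a unit, then
`W` is divisible by every power of `π` up to half of the valuation of `p ^ N`. -/
theorem pow_succ_dvd_of_mul_map_eq_pow {π W : R} {p N : ℕ} {σ : R ≃+* R} (hπ : Prime π)
    (hσ : Associated (σ π) π) (hp : Associated (π ^ (p - 1)) (p : R))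
    (hW : W * σ W = (p : R) ^ N) (C : ℕ) (hC : 2 * C < N * (p - 1)) : π ^ (C + 1) ∣ W := by
  -- Writing W = π^C u, the product W · σ W is π^(2C) u · σ u up to a unit, so the surplus factor π
  -- of p^N must divide u or σ u, hence u.
  have hdiv : ∀ C : ℕ, 2 * C < N * (p - 1) → π ^ C ∣ W → π ^ (C + 1) ∣ W := by
    rintro C hC ⟨u, hu⟩
    have h1 : π ^ C * π ^ C * π ∣ (π ^ C * π ^ C) * (u * σ u) := by
      have h2 : π ^ C * π ^ C * π ∣ (p : R) ^ N := by
        have h3 : π ^ C * π ^ C * π = π ^ (2 * C + 1) := by ring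
        rw [h3]
        refine (pow_dvd_pow π (show 2 * C + 1 ≤ (p - 1) * N by
          rw [mul_comm (p - 1)]; omega)).trans ?_
        rw [pow_mul]
        exact (hp.pow_pow).dvd
      rw [← hW, hu] at h2
      refine h2.trans ?_
      rw [map_mul, map_pow]
      have : (π ^ C * u) * (σ π ^ C * σ u) = σ π ^ C * (π ^ C * (u * σ u)) := by ring
      rw [this, mul_assoc]
      exact mul_dvd_mul (hσ.pow_pow).dvd dvd_rfl
    have h4 : π ∣ u * σ u :=
      (mul_dvd_mul_iff_left
        (mul_ne_zero (pow_ne_zero _ hπ.ne_zero) (pow_ne_zero _ hπ.ne_zero))).1 h1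
    have h5 : π ∣ u := by
      rcases hπ.dvd_or_dvd h4 with h | h
      · exact h
      · exact (map_dvd_iff σ).1 (hσ.dvd.trans h)
    rw [pow_succ, hu]
    exact mul_dvd_mul_left _ h5
  induction C with
  | zero => exact hdiv 0 hC (by simp)
  | succ C ih => exact hdiv (C + 1) hC (ih (by omega))

end Valuation

section CharacterSum

variable {K : Type*} [Field K] [Fintype K] {R : Type*} [CommRing R]

/-- The Weil sum of a planar monomial has squared absolute value `#K`. -/
theorem sum_addChar_mul_sum_addChar_neg [IsDomain R] {ψ : AddChar K R} (hψ : ψ.IsPrimitive) {d : ℕ}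
    (hF : IsPlanarFunction fun x : K => x ^ d) (b c : K) (hb : b ≠ 0) :
    (∑ x, ψ (b * x ^ d + c * x)) * ∑ x, ψ (-(b * x ^ d + c * x)) = Fintype.card K := by
  classical
  -- After the shift x = y + α, planarity lets the difference in y run once through K when α ≠ 0,
  -- leaving a complete sum of a nontrivial character.
  have hinner : ∀ α : K, ∑ y, ψ (b * (y + α) ^ d + c * (y + α)) * ψ (-(b * y ^ d + c * y)) =
      if α = 0 then (Fintype.card K : R) else 0 := by
    intro α
    split_ifs with hα
    · subst hα
      simp [← AddChar.map_add_eq_mul]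
    · have h1 : ∀ y : K, ψ (b * (y + α) ^ d + c * (y + α)) * ψ (-(b * y ^ d + c * y)) =
          ψ (b * α ^ d + c * α) * ψ (((y + α) ^ d - y ^ d - α ^ d) * b) := by
        intro y
        rw [← AddChar.map_add_eq_mul, ← AddChar.map_add_eq_mul]
        congr 1
        ring
      simp_rw [h1, ← Finset.mul_sum]
      rw [Fintype.sum_bijective _ (hF α hα) (fun y => ψ (((y + α) ^ d - y ^ d - α ^ d) * b))
        (fun z => ψ (z * b)) (fun _ => rfl), AddChar.sum_mulShift b hψ, if_neg hb]
      simp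
  calc (∑ x, ψ (b * x ^ d + c * x)) * ∑ x, ψ (-(b * x ^ d + c * x))
      = ∑ y, ∑ x, ψ (b * x ^ d + c * x) * ψ (-(b * y ^ d + c * y)) := by
        rw [Finset.sum_mul_sum, Finset.sum_comm]
    _ = ∑ y, ∑ α, ψ (b * (y + α) ^ d + c * (y + α)) * ψ (-(b * y ^ d + c * y)) := by
        refine Finset.sum_congr rfl fun y _ => ?_
        exact (Fintype.sum_bijective (fun α => y + α) (AddGroup.addLeft_bijective y) _ _
          fun _ => rfl).symm
    _ = ∑ α, ∑ y, ψ (b * (y + α) ^ d + c * (y + α)) * ψ (-(b * y ^ d + c * y)) :=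
        Finset.sum_comm
    _ = Fintype.card K := by
        simp_rw [hinner]
        simp

/-- If all Weil sums of `x ^ d` lie in an ideal, so do the sums of products of factors
`ψ (b x ^ d + c x) - 1`. -/
theorem sum_prod_addChar_sub_one_mem {ψ : AddChar K R} {d : ℕ} (I : Ideal R)
    (hI : ∀ b c : K, ∑ x, ψ (b * x ^ d + c * x) ∈ I) (L : List (K × K)) :
    ∀ b c : K, ∑ x, ψ (b * x ^ d + c * x) *
      (L.map fun l => ψ (l.1 * x ^ d + l.2 * x) - 1).prod ∈ I := by
  induction L with
  | nil => simpa using hI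
  | cons l L ih =>
    intro b c
    -- Multiplying by one more factor ψ - 1 gives the difference of two sums with shifted
    -- coefficients.
    have h := I.sub_mem (ih (b + l.1) (c + l.2)) (ih b c)
    rw [← Finset.sum_sub_distrib] at h
    convert h using 2 with x
    rw [List.map_cons, List.prod_cons]
    have : ψ ((b + l.1) * x ^ d + (c + l.2) * x) =
        ψ (b * x ^ d + c * x) * ψ (l.1 * x ^ d + l.2 * x) := by
      rw [← AddChar.map_add_eq_mul]; congr 1; ring
    rw [this]
    ring

end CharacterSum

/-! ### From Weil sums to vanishing power sums -/

section Trace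

variable {K : Type*} [Field K] [Fintype K] {p N : ℕ}

/-- Each factor ψ - 1 contributes one π, while the whole sum is divisible by one power of π more
than the number of factors. Cancelling and reducing modulo π leaves the traces. -/
theorem sum_prod_trace_eq_zero [hp : Fact p.Prime] [Algebra (ZMod p) K]
    (hK : Fintype.card K = p ^ N) {d : ℕ}
    (hF : IsPlanarFunction fun x : K => x ^ d) (L : List (K × K))
    (hL : 2 * L.length < N * (p - 1)) :
    ∑ x : K, (L.map fun l => Algebra.trace (ZMod p) K (l.1 * x ^ d + l.2 * x)).prod = 0 := by
  classical
  obtain ⟨R, _, _, ζ, σ, hζ, hσζ, hπ, hram, hdvd⟩ := exists_cyclotomic_ring p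
  set π := ζ - 1 with hπdef
  have hζp : ζ ^ p = 1 := hζ.pow_eq_one
  let ψ : AddChar K R :=
    (AddChar.zmodChar p hζp).compAddMonoidHom (Algebra.trace (ZMod p) K).toAddMonoidHom
  have hψval : ∀ x, ψ x = ζ ^ (Algebra.trace (ZMod p) K x).val := fun x => rfl
  have hψ : ψ.IsPrimitive := by
    apply AddChar.IsPrimitive.of_ne_one
    rw [AddChar.ne_one_iff]
    have hnd := (traceForm_nondegenerate (ZMod p) K).1 (1 : K)
    by_contra! hcon
    refine one_ne_zero (hnd fun y => ?_)
    rw [Algebra.traceForm_apply, one_mul]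
    have h1 := hcon y
    rw [hψval, ← pow_zero ζ] at h1
    exact (ZMod.val_eq_zero _).1 (hζ.pow_inj (ZMod.val_lt _) hp.out.pos h1)
  have hσψ : ∀ x, σ (ψ x) = ψ (-x) := by
    intro x
    have h1 : ψ (-x) * ψ x = 1 := by rw [← AddChar.map_add_eq_mul]; simp
    have h2 : σ (ψ x) * ψ x = 1 := by
      rw [hψval, map_pow, ← mul_pow, hσζ, one_pow]
    have h3 : ψ x ≠ 0 := right_ne_zero_of_mul_eq_one h1
    exact mul_right_cancel₀ h3 (h2.trans h1.symm)
  have hσπ : Associated (σ π) π := by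
    have hu : IsUnit (-ζ) := (IsUnit.of_mul_eq_one_right _ hσζ).neg
    obtain ⟨u, hu⟩ := hu
    refine ⟨u, ?_⟩
    rw [hu, hπdef, map_sub, map_one]
    linear_combination -hσζ
  have hmem : ∀ b c : K, ∑ x, ψ (b * x ^ d + c * x) ∈ Ideal.span {π ^ (L.length + 1)} := by
    intro b c
    rw [Ideal.mem_span_singleton]
    have hcard : π ^ (L.length + 1) ∣ (Fintype.card K : R) := by
      rw [hK]
      push_cast
      refine (pow_dvd_pow π (show L.length + 1 ≤ (p - 1) * N by
        rw [mul_comm (p - 1)]; omega)).trans ?_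
      rw [pow_mul]
      exact (hram.pow_pow).dvd
    -- For b = 0 the sum is q or 0 by orthogonality; otherwise the squared absolute value gives the
    -- valuation.
    by_cases hb : b = 0
    · subst hb
      have := AddChar.sum_mulShift c hψ
      simp only [zero_mul, zero_add, mul_comm c]
      rw [this]
      split_ifs
      · exact hcard
      · simp
    · refine pow_succ_dvd_of_mul_map_eq_pow (N := N) hπ hσπ hram ?_ _ hL
      rw [map_sum]
      simp_rw [hσψ]
      rw [sum_addChar_mul_sum_addChar_neg hψ hF b c hb, hK]
      push_cast
      rfl
  have hsum := sum_prod_addChar_sub_one_mem _ hmem L 0 0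
  rw [Ideal.mem_span_singleton] at hsum
  -- The quotient (ζ^t - 1)/(ζ - 1) is a geometric sum of t terms, congruent to t modulo π because ζ
  -- ≡ 1.
  let g : K → R := fun x => ∑ i ∈ range (Algebra.trace (ZMod p) K x).val, ζ ^ i
  have hg : ∀ x, ψ x - 1 = π * g x := fun x => by
    rw [hψval]; exact (mul_geom_sum ζ _).symm
  have hprod : ∀ x : K, (L.map fun l => ψ (l.1 * x ^ d + l.2 * x) - 1).prod =
      π ^ L.length * (L.map fun l => g (l.1 * x ^ d + l.2 * x)).prod := by
    intro x
    simp_rw [hg]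
    rw [List.prod_map_mul]
    simp
  have h1 : π ∣ ∑ x : K, (L.map fun l => g (l.1 * x ^ d + l.2 * x)).prod := by
    have : ∑ x : K, ψ (0 * x ^ d + 0 * x) *
        (L.map fun l => ψ (l.1 * x ^ d + l.2 * x) - 1).prod =
        π ^ L.length * ∑ x : K, (L.map fun l => g (l.1 * x ^ d + l.2 * x)).prod := by
      rw [Finset.mul_sum]
      refine Finset.sum_congr rfl fun x _ => ?_
      rw [hprod]
      simp
    rw [this, pow_succ] at hsum
    exact (mul_dvd_mul_iff_left (pow_ne_zero _ hπ.ne_zero)).1 hsum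
  let I : Ideal R := Ideal.span {π}
  let φ := Ideal.Quotient.mk I
  have hφπ : φ π = 0 := Ideal.Quotient.eq_zero_iff_mem.2 (Ideal.mem_span_singleton_self π)
  have hφζ : φ ζ = 1 := by
    have : φ ζ - φ 1 = 0 := by rw [← map_sub]; exact hφπ
    rw [map_one] at this
    exact sub_eq_zero.1 this
  have hφg : ∀ x, φ (g x) = ((Algebra.trace (ZMod p) K x).val : R ⧸ I) := by
    intro x
    simp [g, map_sum, map_pow, hφζ]
  have h2 : φ (∑ x : K, (L.map fun l => g (l.1 * x ^ d + l.2 * x)).prod) =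
      ((∑ x : K, (L.map fun l =>
        (Algebra.trace (ZMod p) K (l.1 * x ^ d + l.2 * x)).val).prod : ℕ) : R ⧸ I) := by
    rw [map_sum, Nat.cast_sum]
    refine Finset.sum_congr rfl fun x _ => ?_
    rw [map_list_prod, List.map_map, Nat.cast_list_prod, List.map_map]
    congr 1
    refine List.map_congr_left fun l _ => ?_
    simp [hφg]
  have h3 : φ (∑ x : K, (L.map fun l => g (l.1 * x ^ d + l.2 * x)).prod) = 0 :=
    Ideal.Quotient.eq_zero_iff_mem.2 (Ideal.mem_span_singleton.2 h1)
  rw [h2, ← map_natCast φ, Ideal.Quotient.eq_zero_iff_mem, Ideal.mem_span_singleton, hdvd,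
    ← CharP.cast_eq_zero_iff (ZMod p) p] at h3
  rw [← h3, Nat.cast_sum]
  refine Finset.sum_congr rfl fun x _ => ?_
  rw [Nat.cast_list_prod, List.map_map]
  congr 1
  refine List.map_congr_left fun l _ => ?_
  simp

/-- A linearized polynomial of degree at most p^(N-1) < #K vanishing on all of K is zero. -/
theorem eq_zero_of_sum_pow_mul_eq_zero [hp : Fact p.Prime] (hK : Fintype.card K = p ^ N) (c : ℕ → K)
    (h : ∀ b : K, ∑ t ∈ range N, b ^ p ^ t * c t = 0) (t : ℕ) (ht : t < N) : c t = 0 := by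
  classical
  let P : Polynomial K := ∑ t ∈ range N, Polynomial.monomial (p ^ t) (c t)
  have hP : P = 0 := by
    refine Polynomial.eq_zero_of_natDegree_lt_card_of_eval_eq_zero' P Finset.univ
      (fun b _ => ?_) ?_
    · simp only [P, Polynomial.eval_finsetSum, Polynomial.eval_monomial]
      rw [← h b]
      exact Finset.sum_congr rfl fun _ _ => mul_comm _ _
    · rw [Finset.card_univ, hK]
      refine lt_of_le_of_lt (Polynomial.natDegree_sum_le_of_forall_le (n := p ^ (N - 1)) _ _ ?_) ?_
      · intro s hs
        refine (Polynomial.natDegree_monomial_le _).trans ?_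
        exact Nat.pow_le_pow_right hp.out.pos (by have := Finset.mem_range.1 hs; omega)
      · exact Nat.pow_lt_pow_right hp.out.one_lt (by omega)
  have hc : P.coeff (p ^ t) = c t := by
    simp only [P, Polynomial.finsetSum_coeff, Polynomial.coeff_monomial]
    rw [Finset.sum_eq_single t]
    · simp
    · intro s _ hs
      rw [if_neg]
      exact fun h => hs (Nat.pow_right_injective hp.out.two_le h)
    · intro h
      exact absurd (Finset.mem_range.2 ht) h
  rw [← hc, hP, Polynomial.coeff_zero]

theorem pow_pow_mod (hK : Fintype.card K = p ^ N) (x : K) (s : ℕ) :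
    x ^ p ^ s = x ^ p ^ (s % N) := by
  conv_lhs => rw [← Nat.mod_add_div s N, pow_add, pow_mul, pow_mul p, ← hK]
  exact FiniteField.pow_card_pow _ _

/-- The trace is the sum of the Frobenius powers. As the coefficient of each factor is free, its
Frobenius components can be separated one factor at a time; the arbitrary weight `G` absorbs the
factors already treated. -/
theorem sum_prod_pow_eq_zero_of_trace [hp : Fact p.Prime] [Algebra (ZMod p) K] {ι : Type*}
    (hK : Fintype.card K = p ^ N) (hN : 0 < N)
    (f : ι → K → K) (us : List ι) : ∀ G : K → K,
    (∀ M : List (K × ι), M.map Prod.snd = us → ∑ x : K, G x * (M.map fun m =>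
      algebraMap (ZMod p) K (Algebra.trace (ZMod p) K (m.1 * f m.2 x))).prod = 0) →
    ∀ M : List (ℕ × ι), M.map Prod.snd = us →
      ∑ x : K, G x * (M.map fun m => f m.2 x ^ p ^ m.1).prod = 0 := by
  have hfin : Module.finrank (ZMod p) K = N := by
    have h1 := Module.card_eq_pow_finrank (K := ZMod p) (V := K)
    rw [hK, ZMod.card] at h1
    exact (Nat.pow_right_injective hp.out.two_le h1).symm
  induction us with
  | nil =>
    intro G h M hM
    have h0 := h [] rfl
    have : M = [] := List.map_eq_nil_iff.1 hM
    subst this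
    simpa using h0
  | cons u us ih =>
    intro G h M hM
    obtain ⟨⟨s, u'⟩, M, rfl⟩ : ∃ m M', M = m :: M' := by
      cases M with
      | nil => simp at hM
      | cons m M => exact ⟨m, M, rfl⟩
    simp only [List.map_cons, List.cons.injEq] at hM
    obtain ⟨rfl, hM⟩ := hM
    have key := ih (fun x => G x * f u' x ^ p ^ s) (fun B hB => ?_) M hM
    · simpa only [List.map_cons, List.prod_cons, mul_assoc] using key
    let c : ℕ → K := fun t => ∑ x : K, G x * f u' x ^ p ^ t * (B.map fun m =>
      algebraMap (ZMod p) K (Algebra.trace (ZMod p) K (m.1 * f m.2 x))).prod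
    have hc : ∀ b : K, ∑ t ∈ range N, b ^ p ^ t * c t = 0 := by
      intro b
      have hb := h ((b, u') :: B) (by simp [hB])
      rw [← hb]
      simp only [c, Finset.mul_sum]
      rw [Finset.sum_comm]
      refine Finset.sum_congr rfl fun x _ => ?_
      rw [List.map_cons, List.prod_cons, FiniteField.algebraMap_trace_eq_sum_pow, hfin,
        Nat.card_zmod, Finset.sum_mul, Finset.mul_sum]
      refine Finset.sum_congr rfl fun t _ => ?_
      rw [mul_pow]
      ring
    have := eq_zero_of_sum_pow_mul_eq_zero hK c hc (s % N) (Nat.mod_lt _ hN)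
    simp only [c, ← pow_pow_mod hK] at this
    exact this

end Trace

/-! ### The weight condition and base-p digits -/

/-- `m` is a sum of `c` powers of `p`. -/
def IsSumPow (p c m : ℕ) : Prop :=
  ∃ l : List ℕ, l.length = c ∧ (l.map fun s => p ^ s).sum = m

/-- The `p`-weight condition satisfied by the exponent of a planar monomial. -/
theorem not_dvd_of_isPlanarFunction {K : Type*} [Field K] {p N d : ℕ} (hp : p.Prime)
    (hK : Nat.card K = p ^ N) (hN : 0 < N) (hd : 0 < d) (hF : IsPlanarFunction fun x : K => x ^ d)
    {c₁ c₂ e l : ℕ} (he : IsSumPow p c₁ e) (hl : IsSumPow p c₂ l) (hc : 0 < c₁ + c₂)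
    (hlt : 2 * (c₁ + c₂) < N * (p - 1)) : ¬ p ^ N - 1 ∣ d * e + l := by
  classical
  have : Fact p.Prime := ⟨hp⟩
  have hfinite : Finite K := Nat.finite_of_card_ne_zero (by rw [hK]; exact pow_ne_zero _ hp.ne_zero)
  have := Fintype.ofFinite K
  have hK' : Fintype.card K = p ^ N := by rw [← Nat.card_eq_fintype_card, hK]
  have hchar : CharP K p := charP_of_card_eq_prime_pow (f := N) hK'
  let := ZMod.algebra K p
  obtain ⟨E, rfl, rfl⟩ := he
  obtain ⟨T, rfl, rfl⟩ := hl
  let f : Bool → K → K := fun i x => if i then x ^ d else x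
  let M : List (ℕ × Bool) := E.map (fun s => (s, true)) ++ T.map (fun s => (s, false))
  have key := sum_prod_pow_eq_zero_of_trace hK' hN f (M.map Prod.snd) (fun _ => 1) (fun B hB => ?_)
    M rfl
  · intro hdvd
    have hval : ∀ x : K, (M.map fun m => f m.2 x ^ p ^ m.1).prod =
        x ^ (d * (E.map fun s => p ^ s).sum + (T.map fun s => p ^ s).sum) := by
      intro x
      have h1 : ∀ (y : K) (E : List ℕ),
          (E.map fun s => y ^ p ^ s).prod = y ^ (E.map fun s => p ^ s).sum := by
        intro y E
        induction E with
        | nil => simp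
        | cons s E ih => simp [ih, pow_add]
      simp only [M, List.map_append, List.map_map, List.prod_append, pow_add, pow_mul]
      rw [← h1, ← h1]
      rfl
    simp_rw [hval, one_mul] at key
    -- A positive exponent makes the term at x = 0 vanish, so the sum is q - 1 = -1 in K; exponent 0
    -- would give q = 0 and no contradiction.
    have hpos : 0 < d * (E.map fun s => p ^ s).sum + (T.map fun s => p ^ s).sum := by
      have h2 : ∀ E : List ℕ, E.length ≤ (E.map fun s => p ^ s).sum := by
        intro E
        induction E with
        | nil => simp
        | cons s E ih =>
          have := Nat.pow_pos (n := s) hp.pos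
          simp only [List.length_cons, List.map_cons, List.sum_cons]
          omega
      have h3 := h2 E
      have h4 := h2 T
      have h5 := Nat.le_mul_of_pos_left (E.map fun s => p ^ s).sum hd
      omega
    obtain ⟨m, hm⟩ := hdvd
    rw [hm] at key hpos
    have hone : ∀ x : K, x ^ ((p ^ N - 1) * m) = if x = 0 then 0 else 1 := by
      intro x
      split_ifs with hx
      · rw [hx, zero_pow hpos.ne']
      · rw [pow_mul, ← hK', FiniteField.pow_card_sub_one_eq_one x hx, one_pow]
    simp_rw [hone] at key
    rw [Finset.sum_ite, Finset.sum_const_zero, zero_add, Finset.sum_const, nsmul_eq_mul, mul_one,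
      Finset.filter_not, Finset.card_sdiff_of_subset (Finset.filter_subset _ _),
      Finset.filter_eq' _ (0 : K), if_pos (Finset.mem_univ _), Finset.card_singleton,
      Finset.card_univ, hK', Nat.cast_sub (Nat.one_le_pow _ _ hp.pos)] at key
    push_cast at key
    rw [CharP.cast_eq_zero K p, zero_pow hN.ne'] at key
    simp at key
  · have hlen : B.length = E.length + T.length := by
      have := congrArg List.length hB
      simpa [M] using this
    have h := sum_prod_trace_eq_zero (p := p) hK' hF
      (B.map fun b => if b.2 then (b.1, 0) else (0, b.1)) (by rw [List.length_map, hlen]; exact hlt)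
    have h' := congrArg (algebraMap (ZMod p) K) h
    rw [map_zero, map_sum] at h'
    rw [← h']
    refine Finset.sum_congr rfl fun x _ => ?_
    rw [one_mul, map_list_prod, List.map_map, List.map_map]
    congr 1
    refine List.map_congr_left fun b _ => ?_
    rcases b with ⟨b, i⟩
    cases i <;> simp [f]

section IsSumPow

variable {p : ℕ}

theorem IsSumPow.add {c c' m m' : ℕ} (h : IsSumPow p c m) (h' : IsSumPow p c' m') :
    IsSumPow p (c + c') (m + m') := by
  obtain ⟨l, rfl, rfl⟩ := h
  obtain ⟨l', rfl, rfl⟩ := h'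
  exact ⟨l ++ l', by simp, by simp⟩

theorem IsSumPow.pow_mul {c m : ℕ} (h : IsSumPow p c m) (i : ℕ) : IsSumPow p c (p ^ i * m) := by
  obtain ⟨l, rfl, rfl⟩ := h
  refine ⟨l.map (i + ·), by simp, ?_⟩
  rw [List.map_map, ← List.sum_map_mul_left]
  simp [Function.comp_def, pow_add]

theorem IsSumPow.mul_pow_self (p k i : ℕ) : IsSumPow p k (k * p ^ i) :=
  ⟨List.replicate k i, by simp, by simp⟩

theorem IsSumPow.natural (p k : ℕ) : IsSumPow p k k := by
  simpa using IsSumPow.mul_pow_self p k 0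

theorem IsSumPow.sum_range (p : ℕ) (f : ℕ → ℕ) (n : ℕ) :
    IsSumPow p (∑ s ∈ range n, f s) (∑ s ∈ range n, f s * p ^ s) := by
  induction n with
  | zero => exact ⟨[], rfl, rfl⟩
  | succ n ih =>
    rw [sum_range_succ, sum_range_succ]
    exact ih.add (IsSumPow.mul_pow_self p _ n)

end IsSumPow

theorem sum_range_digit (p N c : ℕ) : ∑ t ∈ range c, N / p ^ t % p * p ^ t = N % p ^ c := by
  induction c with
  | zero => simp [Nat.mod_one]
  | succ c ih => rw [sum_range_succ, ih, Nat.mod_pow_succ]; ring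

theorem two_mul_sum_half_pow_add_one {p h : ℕ} (hp : p = 2 * h + 1) (i : ℕ) :
    2 * (∑ s ∈ range i, h * p ^ s) + 1 = p ^ i := by
  induction i with
  | zero => simp
  | succ i ih =>
    rw [sum_range_succ, pow_succ]
    subst hp
    linear_combination ih

/-- The exponent `(1 + p ^ n) + κ (1 - p ^ n)` modulo `p ^ (2 n) - 1` satisfies the weight condition
of planar monomials. -/
def WeightCondition (p n : ℕ) (κ : ℤ) : Prop :=
  ∀ c₁ c₂ e l : ℕ, IsSumPow p c₁ e → IsSumPow p c₂ l → 0 < c₁ + c₂ → c₁ + c₂ < n * (p - 1) →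
    ¬ ((p : ℤ) ^ n) ^ 2 - 1 ∣ ((1 + (p : ℤ) ^ n) + κ * (1 - (p : ℤ) ^ n)) * e + l

/-- Multiplication by p^n swaps 1 and p^n modulo p^(2n) - 1, which changes the sign of κ and
preserves weights. -/
theorem WeightCondition.neg {p n : ℕ} {κ : ℤ} (h : WeightCondition p n κ) :
    WeightCondition p n (-κ) := by
  intro c₁ c₂ e l he hl h0 hlt hdvd
  refine h c₁ c₂ _ l (he.pow_mul n) hl h0 hlt ?_
  obtain ⟨z, hz⟩ := hdvd
  refine ⟨z + (1 - κ) * e, ?_⟩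
  push_cast
  linear_combination hz

theorem WeightCondition.congr {p n : ℕ} {κ κ' : ℤ} (h : WeightCondition p n κ)
    (hκ : (p : ℤ) ^ n + 1 ∣ κ - κ') : WeightCondition p n κ' := by
  intro c₁ c₂ e l he hl h0 hlt hdvd
  refine h c₁ c₂ e l he hl h0 hlt ?_
  obtain ⟨z, hz⟩ := hdvd
  obtain ⟨y, hy⟩ := hκ
  refine ⟨z - y * e, ?_⟩
  linear_combination hz + (1 - (p : ℤ) ^ n) * e * hy

/-- A digitwise criterion for the failure of the weight condition. -/
theorem not_weightCondition_of_digits {p n : ℕ} (hp : 0 < p) {κ : ℤ} (δ : ℕ → ℤ) (E : ℕ → ℕ)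
    (h1 : ∀ s < n, (δ s).natAbs ≤ E s) (h2 : ∀ s < n, E s + (δ s).natAbs ≤ p - 1)
    (h3 : ∃ s < n, δ s ≠ 0)
    (h4 : (p : ℤ) ^ n + 1 ∣ κ * (∑ s ∈ range n, δ s * (p : ℤ) ^ s) -
      ((∑ s ∈ range n, (E s : ℤ) * (p : ℤ) ^ s) + 1)) : ¬ WeightCondition p n κ := by
  intro hW
  have hU := IsSumPow.sum_range p (fun s => (δ s).toNat) n
  have hV := (IsSumPow.sum_range p (fun s => (-δ s).toNat) n).pow_mul n
  have hX := IsSumPow.sum_range p (fun s => p - 1 - E s - (δ s).natAbs) n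
  have hY := (IsSumPow.sum_range p (fun s => E s - (δ s).natAbs) n).pow_mul n
  have hcount : (∑ s ∈ range n, (δ s).toNat + ∑ s ∈ range n, (-δ s).toNat) +
      (∑ s ∈ range n, (p - 1 - E s - (δ s).natAbs) + ∑ s ∈ range n, (E s - (δ s).natAbs)) +
      ∑ s ∈ range n, (δ s).natAbs = n * (p - 1) := by
    simp only [← sum_add_distrib]
    rw [← smul_eq_mul, ← Finset.card_range n, ← Finset.sum_const, Finset.card_range]
    refine sum_congr rfl fun s hs => ?_
    have := h1 s (mem_range.1 hs)
    have := h2 s (mem_range.1 hs)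
    omega
  have habs : ∑ s ∈ range n, (δ s).toNat + ∑ s ∈ range n, (-δ s).toNat =
      ∑ s ∈ range n, (δ s).natAbs := by
    rw [← sum_add_distrib]
    refine sum_congr rfl fun s _ => ?_
    omega
  have hpos : 0 < ∑ s ∈ range n, (δ s).natAbs := by
    obtain ⟨s, hs, hδ⟩ := h3
    exact Finset.sum_pos' (fun _ _ => Nat.zero_le _)
      ⟨s, mem_range.2 hs, Int.natAbs_pos.2 hδ⟩
  -- Let U, V be the positive and negative parts of δ, and Q = p^n. With e = U + QV and l = X + QY,
  -- the total weight is n(p - 1) - ∑ |δ s|, and the tested number is (1 - Q)(κ(U - V) - (E + 1))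
  -- modulo Q² - 1.
  refine hW _ _ _ _ (hU.add hV) (hX.add hY) (by omega) (by omega) ?_
  set U : ℤ := ∑ s ∈ range n, ((δ s).toNat : ℤ) * (p : ℤ) ^ s with hUdef
  set V : ℤ := ∑ s ∈ range n, ((-δ s).toNat : ℤ) * (p : ℤ) ^ s with hVdef
  set Es : ℤ := ∑ s ∈ range n, (E s : ℤ) * (p : ℤ) ^ s with hEdef
  have hD : ∑ s ∈ range n, δ s * (p : ℤ) ^ s = U - V := by
    rw [hUdef, hVdef, ← sum_sub_distrib]
    refine sum_congr rfl fun s _ => ?_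
    have : δ s = ((δ s).toNat : ℤ) - ((-δ s).toNat : ℤ) := by omega
    rw [← sub_mul, ← this]
  have hgeom : ∑ s ∈ range n, ((p : ℤ) - 1) * (p : ℤ) ^ s = (p : ℤ) ^ n - 1 := by
    rw [← Finset.mul_sum, mul_geom_sum]
  have hXv : ((∑ s ∈ range n, (p - 1 - E s - (δ s).natAbs) * p ^ s : ℕ) : ℤ) =
      (p : ℤ) ^ n - 1 - Es - (U + V) := by
    rw [← hgeom, hUdef, hVdef, hEdef, Nat.cast_sum, ← sum_add_distrib, ← sum_sub_distrib,
      ← sum_sub_distrib]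
    refine sum_congr rfl fun s hs => ?_
    have := h1 s (mem_range.1 hs)
    have := h2 s (mem_range.1 hs)
    have h5 : ((p - 1 - E s - (δ s).natAbs : ℕ) : ℤ) =
      (p : ℤ) - 1 - E s - (((δ s).toNat : ℤ) + ((-δ s).toNat : ℤ)) := by omega
    push_cast [h5]
    ring
  have hYv : ((∑ s ∈ range n, (E s - (δ s).natAbs) * p ^ s : ℕ) : ℤ) = Es - (U + V) := by
    rw [hUdef, hVdef, hEdef, Nat.cast_sum, ← sum_add_distrib, ← sum_sub_distrib]
    refine sum_congr rfl fun s hs => ?_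
    have := h1 s (mem_range.1 hs)
    have h5 : ((E s - (δ s).natAbs : ℕ) : ℤ) =
      (E s : ℤ) - (((δ s).toNat : ℤ) + ((-δ s).toNat : ℤ)) := by omega
    push_cast [h5]
    ring
  have hUv : ((∑ s ∈ range n, (δ s).toNat * p ^ s : ℕ) : ℤ) = U := by
    rw [hUdef]; push_cast; rfl
  have hVv : ((∑ s ∈ range n, (-δ s).toNat * p ^ s : ℕ) : ℤ) = V := by
    rw [hVdef]; push_cast; rfl
  rw [hD] at h4
  obtain ⟨z, hz⟩ := h4
  refine ⟨V * (1 - κ) - z, ?_⟩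
  rw [Nat.cast_add, Nat.cast_add, Nat.cast_mul, Nat.cast_mul, hXv, hYv, hUv, hVv]
  push_cast
  linear_combination (1 - (p : ℤ) ^ n) * hz

/-! ### Values of κ divisible by p -/

/-- Failure of the weight condition for `κ = a p ^ i` when a small even multiple of `a` has a
digit of intermediate size. -/
theorem not_weightCondition_of_middle_digit {p h i c a g r : ℕ} (hp : p = 2 * h + 1) (hi : 0 < i)
    (hg : g ≤ h) (hr : r < c) (hN : 2 * g * a < p ^ c)
    (h0 : 1 ≤ (2 * g * a) % p) (h1 : 2 ≤ 2 * g * a / p ^ r % p) (h2 : 2 * g * a / p ^ r % p + 3 ≤ p)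
    (h3 : r = 0 → 3 ≤ (2 * g * a) % p) :
    ¬ WeightCondition p (i + c) ((a : ℤ) * (p : ℤ) ^ i) := by
  intro hW
  obtain ⟨i, rfl⟩ : ∃ i', i = i' + 1 := ⟨i - 1, by omega⟩
  set N := 2 * g * a with hNdef
  set m := ∑ s ∈ range i, h * p ^ s with hm
  have hmv : 2 * m + 1 = p ^ i := two_mul_sum_half_pow_add_one hp i
  have hmrep : IsSumPow p (i * h) m := by
    simpa using IsSumPow.sum_range p (fun _ => h) i
  -- The low i + 1 digits of the two halves of e use the full weight (i + 1)(p - 1), and the halves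
  -- differ by 2g. The common power at position i + 1 + r costs 2 but lowers digit r of both `x` and
  -- `y` by 2, so the total ends 2 below the bound.
  have hu := ((IsSumPow.natural p (h + g)).add (hmrep.pow_mul 1)).add
    (IsSumPow.mul_pow_self p 1 (i + 1 + r))
  have hv := (((IsSumPow.natural p (h - g)).add (hmrep.pow_mul 1)).add
    (IsSumPow.mul_pow_self p 1 (i + 1 + r))).pow_mul (i + 1 + c)
  let x : ℕ → ℕ := fun t => p - 1 - N / p ^ t % p - (if t = r then 2 else 0)
  let y : ℕ → ℕ := fun t => N / p ^ t % p - (if t = 0 then 1 else 0) - (if t = r then 2 else 0)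
  have hX := ((IsSumPow.sum_range p x c).pow_mul (i + 1)).add (IsSumPow.natural p 1)
  have hY := ((IsSumPow.sum_range p y c).pow_mul (i + 1)).pow_mul (i + 1 + c)
  have hx : ∀ t, x t + N / p ^ t % p + (if t = r then 2 else 0) = p - 1 := by
    intro t
    have := Nat.mod_lt (N / p ^ t) (show 0 < p by omega)
    simp only [x]
    split_ifs with htr
    · subst htr; omega
    · omega
  have hy : ∀ t, y t + (if t = 0 then 1 else 0) + (if t = r then 2 else 0) = N / p ^ t % p := by
    intro t
    simp only [y]
    split_ifs with ht0 htr htr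
    · subst ht0; subst htr; simp only [pow_zero, Nat.div_one]; have := h3 rfl; omega
    · subst ht0; simp only [pow_zero, Nat.div_one]; omega
    · subst htr; omega
    · omega
  have hc0 : 0 < c := by omega
  have hcount : ∑ t ∈ range c, x t + ∑ t ∈ range c, y t + 5 = c * (p - 1) := by
    have hs : ∑ t ∈ range c, (x t + y t + ((if t = 0 then 1 else 0) + (if t = r then 4 else 0))) =
        c * (p - 1) := by
      rw [← smul_eq_mul, ← Finset.card_range c, ← Finset.sum_const, Finset.card_range]
      refine sum_congr rfl fun t _ => ?_
      have := hx t
      have := hy t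
      split_ifs at * <;> omega
    simp only [sum_add_distrib, sum_ite_eq', mem_range, hc0, hr, if_true] at hs
    omega
  have hxv : ((∑ t ∈ range c, x t * p ^ t : ℕ) : ℤ) = (p : ℤ) ^ c - 1 - N - 2 * (p : ℤ) ^ r := by
    have hs : ∑ t ∈ range c, (x t * p ^ t + N / p ^ t % p * p ^ t +
        (if t = r then 2 * p ^ t else 0)) + 1 = p ^ c := by
      rw [← two_mul_sum_half_pow_add_one hp c, Finset.mul_sum]
      congr 1
      refine sum_congr rfl fun t _ => ?_
      have : 2 * h = p - 1 := by omega
      rw [← mul_assoc, this, ← hx t]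
      split_ifs <;> ring
    simp only [sum_add_distrib, sum_ite_eq', mem_range, hr, if_true, sum_range_digit,
      Nat.mod_eq_of_lt hN] at hs
    zify at hs
    push_cast
    linarith
  have hyv : ((∑ t ∈ range c, y t * p ^ t : ℕ) : ℤ) = N - 1 - 2 * (p : ℤ) ^ r := by
    have hs : ∑ t ∈ range c, (y t * p ^ t + (if t = 0 then p ^ t else 0) +
        (if t = r then 2 * p ^ t else 0)) = N := by
      rw [← Nat.mod_eq_of_lt hN, ← sum_range_digit p N c]
      refine sum_congr rfl fun t _ => ?_
      rw [← hy t]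
      split_ifs <;> ring
    simp only [sum_add_distrib, sum_ite_eq', mem_range, hr, hc0, if_true, pow_zero] at hs
    zify at hs
    push_cast
    linarith
  refine hW _ _ _ _ (hu.add hv) (hX.add hY) (by omega) ?_ ?_
  · have e1 : (i + 1 + c) * (p - 1) = i * (2 * h) + 2 * h + c * (p - 1) := by
      rw [hp]; simp only [Nat.add_sub_cancel]; ring
    have e2 : i * (2 * h) = 2 * (i * h) := by ring
    omega
  · have hgh : ((h - g : ℕ) : ℤ) = h - g := Nat.cast_sub hg
    have hmz : 2 * (m : ℤ) + 1 = (p : ℤ) ^ i := by exact_mod_cast hmv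
    have hpz : (p : ℤ) = 2 * h + 1 := by exact_mod_cast hp
    have hNz : (N : ℤ) = 2 * g * a := by rw [hNdef]; push_cast; ring
    set V : ℤ := (h - g) + p * m + (p : ℤ) ^ (i + 1 + r) with hV
    refine ⟨V * (1 - a * (p : ℤ) ^ (i + 1)), ?_⟩
    simp only [Nat.cast_add, Nat.cast_mul, Nat.cast_pow, hxv, hyv, hgh, Nat.cast_one]
    rw [hNz, hV]
    have hw : 2 * (h : ℤ) + 2 * (p * m) = (p : ℤ) ^ (i + 1) - 1 := by
      rw [pow_succ, ← hmz]; linear_combination -hpz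
    simp only [pow_add, pow_one] at hw ⊢
    linear_combination (1 + (p : ℤ) ^ i * p * (p : ℤ) ^ c) * hw

/-- The leading digit of 2a, 4a or 6a avoids 0, 1, p - 2 and p - 1: if 2a has a bad leading part,
then a is at least p^(t+1)/3, and 4a or 6a carries into a small digit at position t + 1. -/
theorem exists_middle_digit {p c a : ℕ} (hp : p.Prime) (hp5 : 5 < p) (ha : ¬ p ∣ a)
    (hac : 3 * a < p ^ c) : ∃ g r : ℕ, g ≤ 3 ∧ r < c ∧ 2 * g * a < p ^ c ∧
      1 ≤ (2 * g * a) % p ∧ 2 ≤ 2 * g * a / p ^ r % p ∧ 2 * g * a / p ^ r % p + 3 ≤ p ∧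
      (r = 0 → 3 ≤ (2 * g * a) % p) := by
  have hp7 : 7 ≤ p := by
    rcases Nat.lt_or_ge p 7 with h | h
    · have : p = 6 := by omega
      subst this
      exact absurd hp (by norm_num)
    · exact h
  have ha0 : a ≠ 0 := by rintro rfl; exact ha (dvd_zero p)
  have hmod : ∀ g, 1 ≤ g → g ≤ 3 → 1 ≤ (2 * g * a) % p := by
    intro g hg1 hg3
    rw [Nat.one_le_iff_ne_zero, Ne, ← Nat.dvd_iff_mod_eq_zero, hp.dvd_mul]
    rintro (h | h)
    · have := Nat.le_of_dvd (by omega) h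
      have : p = 6 ∨ p < 6 ∨ 6 < p := by omega
      omega
    · exact ha h
  set t := Nat.log p a with ht
  have hlow : p ^ t ≤ a := Nat.pow_log_le_self p ha0
  have hup : a < p ^ (t + 1) := Nat.lt_pow_succ_log_self hp.one_lt a
  have hpt : 0 < p ^ t := Nat.pow_pos hp.pos
  have hdiv : ∀ (r x lo hi : ℕ), lo * p ^ r ≤ x → x < hi * p ^ r → hi ≤ p →
      lo ≤ x / p ^ r % p ∧ x / p ^ r % p < hi := by
    intro r x lo hi h1 h2 h3
    have hpr : 0 < p ^ r := Nat.pow_pos hp.pos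
    have h4 : x / p ^ r < hi := (Nat.div_lt_iff_lt_mul hpr).2 h2
    have h5 : lo ≤ x / p ^ r := (Nat.le_div_iff_mul_le hpr).2 h1
    rw [Nat.mod_eq_of_lt (by omega)]
    exact ⟨h5, h4⟩
  have htc : t < c := by
    rw [← Nat.pow_lt_pow_iff_right hp.one_lt]; omega
  rcases Nat.lt_or_ge (2 * a) ((p - 2) * p ^ t) with hcase | hcase
  · have hle : (p - 2) * p ^ t ≤ p ^ c := by
      calc (p - 2) * p ^ t ≤ p * p ^ t := Nat.mul_le_mul_right _ (by omega)
        _ = p ^ (t + 1) := by ring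
        _ ≤ p ^ c := Nat.pow_le_pow_right hp.pos htc
    by_cases ha1 : a = 1
    · subst ha1
      have ht0 : t = 0 := by simp [ht]
      have hpc : p ≤ p ^ c := Nat.le_self_pow (by omega) p
      -- For a = 1 the digit 2 of 2a is too small at r = 0, where 3 is required, so 4a is used.
      refine ⟨2, 0, by norm_num, by omega, by omega, hmod 2 (by norm_num) (by norm_num), ?_, ?_, ?_⟩
      all_goals simp only [pow_zero, Nat.div_one]; rw [Nat.mod_eq_of_lt (by omega)]; omega
    · have h1 := hdiv t (2 * 1 * a) 2 (p - 2) (by omega) (by omega) (by omega)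
      refine ⟨1, t, by norm_num, htc, by omega, hmod 1 le_rfl (by norm_num), h1.1, by omega, ?_⟩
      intro ht0
      rw [ht0, pow_zero, mul_one] at hcase
      rw [Nat.mod_eq_of_lt (by omega)]
      omega
  · have hpow : p ^ (t + 1) = p * p ^ t := by ring
    obtain ⟨k, hk⟩ : ∃ k, p = k + 7 := ⟨p - 7, by omega⟩
    have hcase' : p ^ (t + 1) ≤ 3 * a := by
      have h1 : (p - 2) * p ^ t = k * p ^ t + 5 * p ^ t := by
        rw [← add_mul]; congr 1; omega
      have h2 : p ^ (t + 1) = k * p ^ t + 7 * p ^ t := by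
        rw [hpow, ← add_mul, ← hk]
      omega
    have htc' : t + 1 < c := by
      rw [← Nat.pow_lt_pow_iff_right hp.one_lt]; omega
    have hle : 7 * p ^ (t + 1) ≤ p ^ c := by
      calc 7 * p ^ (t + 1) ≤ p * p ^ (t + 1) := Nat.mul_le_mul_right _ hp7
        _ = p ^ (t + 2) := by ring
        _ ≤ p ^ c := Nat.pow_le_pow_right hp.pos htc'
    rcases Nat.lt_or_ge (6 * a) (5 * p ^ (t + 1)) with h6 | h6
    · have h1 := hdiv (t + 1) (2 * 3 * a) 2 5 (by omega) (by omega) (by omega)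
      exact ⟨3, t + 1, le_rfl, htc', by omega, hmod 3 (by norm_num) le_rfl, h1.1, by omega,
        by omega⟩
    · have h1 := hdiv (t + 1) (2 * 2 * a) 2 4 (by omega) (by omega) (by omega)
      exact ⟨2, t + 1, by norm_num, htc', by omega, hmod 2 (by norm_num) (by norm_num), h1.1,
        by omega, by omega⟩

/-- Failure of the weight condition for `κ = a p ^ i`, given a multiplier `δ` for which the fractional
part of `a p ^ i δ / (p ^ (i + c) + 1)` has almost all of its digits in the middle. -/
theorem not_weightCondition_of_multiplier {p h i c a : ℕ} (hp : p = 2 * h + 1) (hh : 3 ≤ h)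
    (hi : 0 < i) (hc : 0 < c) {m δ k : ℤ} (hm : 2 * m + 1 = (p : ℤ) ^ i) (hk : |k| ≤ 1)
    (h1 : (m + k) * ((p : ℤ) ^ (i + c) + 1) ≤ a * (p : ℤ) ^ i * δ)
    (h2 : a * (p : ℤ) ^ i * δ < (m + k + 1) * ((p : ℤ) ^ (i + c) + 1))
    (h3 : m ≤ δ) (h4 : δ ≤ 3 * m + 1)
    (h5 : ¬ (p : ℤ) ∣ a * δ) (h6 : ¬ (p : ℤ) ∣ a * δ - 1)
    (h7 : k = 0 ∨ ¬ (p : ℤ) ∣ δ - h ∧ ¬ (p : ℤ) ∣ δ + h) :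
    ¬ WeightCondition p (i + c) ((a : ℤ) * (p : ℤ) ^ i) := by
  have hp0 : 0 < p := by omega
  have hpz : (p : ℤ) = 2 * h + 1 := by exact_mod_cast hp
  rw [abs_le] at hk
  have hmN : ((∑ s ∈ range i, h * p ^ s : ℕ) : ℤ) = m := by
    have := two_mul_sum_half_pow_add_one hp i
    zify at this
    push_cast
    linarith
  have hpi : (p : ℤ) ≤ (p : ℤ) ^ i := le_self_pow₀ (by omega) (by omega)
  have hm3 : 3 ≤ m := by omega
  obtain ⟨q, hq⟩ : (p : ℤ) ∣ (p : ℤ) ^ i := dvd_pow_self _ (by omega)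
  obtain ⟨q', hq'⟩ : (p : ℤ) ∣ (p : ℤ) ^ c := dvd_pow_self _ (by omega)
  have hmmod : ∃ w : ℤ, m = h + p * w := by
    obtain ⟨w, hw⟩ : (p : ℤ) ∣ m - h := by
      have h8 : (p : ℤ) ∣ 2 * (m - h) := ⟨q - 1, by linear_combination hm + hq + hpz⟩
      refine (Int.isCoprime_iff_gcd_eq_one.2 ?_).dvd_of_dvd_mul_left h8
      have : Nat.Coprime (2 * h + 1) 2 := by simp
      rw [hp]
      exact_mod_cast this
    exact ⟨w, by linarith⟩
  obtain ⟨w, hw⟩ := hmmod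
  -- the quotient part of the remainder
  obtain ⟨Z, hZ⟩ : ∃ Z : ℕ, (Z : ℤ) = a * δ - (p : ℤ) ^ c * (m + k) - 1 := by
    refine ⟨(a * δ - (p : ℤ) ^ c * (m + k) - 1).toNat, Int.toNat_of_nonneg ?_⟩
    by_contra hneg
    have hV : a * δ - (p : ℤ) ^ c * (m + k) ≤ 0 := by omega
    have : (p : ℤ) ^ i * (a * δ - (p : ℤ) ^ c * (m + k)) ≤ 0 :=
      mul_nonpos_of_nonneg_of_nonpos (by positivity) hV
    rw [pow_add] at h1
    nlinarith
  have hZlt : Z < p ^ c := by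
    zify
    rw [hZ]
    by_contra hneg
    have hV : (p : ℤ) ^ c + 1 ≤ a * δ - (p : ℤ) ^ c * (m + k) := by omega
    have : (p : ℤ) ^ i * ((p : ℤ) ^ c + 1) ≤ (p : ℤ) ^ i * (a * δ - (p : ℤ) ^ c * (m + k)) :=
      mul_le_mul_of_nonneg_left hV (by positivity)
    rw [pow_add] at h2
    nlinarith
  -- the top digit of the multiplier and the remaining part
  obtain ⟨b, hb, y, hy, hylt⟩ : ∃ b : ℤ, (b = 0 ∨ b = 1) ∧ ∃ y : ℕ,
      (y : ℤ) = δ - b * (p : ℤ) ^ i + m ∧ y < p ^ i := by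
    rcases le_or_gt δ m with hδ | hδ
    · refine ⟨0, Or.inl rfl, (δ + m).toNat, by omega, ?_⟩
      zify
      rw [Int.toNat_of_nonneg (by omega)]
      omega
    · refine ⟨1, Or.inr rfl, (δ - (p : ℤ) ^ i + m).toNat, by omega, ?_⟩
      zify
      rw [Int.toNat_of_nonneg (by omega)]
      omega
  have hymod : (p : ℤ) ∣ y - (δ + h) := ⟨w - b * q, by rw [hy, hw, hq]; ring⟩
  have hZmod : (p : ℤ) ∣ Z - (a * δ - 1) := ⟨-q' * (m + k), by rw [hZ, hq']; ring⟩
  -- The multiplier has balanced digits in [-h, h] below position i and top digit b. Its remainder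
  -- has digits h there, except h - k at position 0, so only positions 0 and i can violate the digit
  -- criterion; the non-divisibility hypotheses rule this out.
  let D : ℕ → ℤ := fun s => if s < i then ((y / p ^ s % p : ℕ) : ℤ) - h else if s = i then b else 0
  let E : ℕ → ℕ := fun s => if s = 0 then ((h : ℤ) - k).toNat else if s < i then h else
    Z / p ^ (s - i) % p
  have hZd : b = 1 → 1 ≤ Z % p ∧ Z % p + 1 ≤ p - 1 := by
    intro _
    have hlt := Nat.mod_lt Z hp0
    have e1 : Z % p ≠ 0 := by
      intro h0
      apply h6
      have : (p : ℤ) ∣ Z := by exact_mod_cast Nat.dvd_of_mod_eq_zero h0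
      have := dvd_sub this hZmod
      rwa [sub_sub_cancel] at this
    have e2 : Z % p ≠ p - 1 := by
      intro h0
      apply h5
      have h9 : p ∣ Z + 1 := by
        have := Nat.div_add_mod Z p
        exact ⟨Z / p + 1, by rw [mul_add, mul_one]; omega⟩
      have h9 : (p : ℤ) ∣ (Z : ℤ) + 1 := by exact_mod_cast h9
      have h10 := dvd_sub h9 hZmod
      rwa [show (Z : ℤ) + 1 - (Z - (a * δ - 1)) = a * δ by ring] at h10
    omega
  have hyd : k = 0 ∨ (1 ≤ y % p ∧ y % p + 1 ≤ p - 1) := by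
    refine h7.imp_right fun ⟨h8, h9⟩ => ?_
    have hlt := Nat.mod_lt y hp0
    have e1 : y % p ≠ 0 := by
      intro h0
      apply h9
      have : (p : ℤ) ∣ y := by exact_mod_cast Nat.dvd_of_mod_eq_zero h0
      have := dvd_sub this hymod
      rwa [sub_sub_cancel] at this
    have e2 : y % p ≠ p - 1 := by
      intro h0
      apply h8
      have h10 : p ∣ y + 1 := by
        have := Nat.div_add_mod y p
        exact ⟨y / p + 1, by rw [mul_add, mul_one]; omega⟩
      have h10 : (p : ℤ) ∣ (y : ℤ) + 1 := by exact_mod_cast h10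
      have h11 := dvd_sub (dvd_sub h10 hymod) (dvd_refl (p : ℤ))
      rwa [show (y : ℤ) + 1 - (y - (δ + h)) - p = δ - h by rw [hpz]; ring] at h11
    omega
  have hEb : ∀ s < i + c, (D s).natAbs ≤ E s ∧ E s + (D s).natAbs ≤ p - 1 := by
    intro s _
    simp only [D, E]
    have hlt := Nat.mod_lt (y / p ^ s) hp0
    have hlt' := Nat.mod_lt (Z / p ^ (s - i)) hp0
    by_cases hs0 : s = 0
    · subst hs0
      simp only [hi, if_true, pow_zero, Nat.div_one]
      simp only [pow_zero, Nat.div_one] at hlt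
      omega
    · by_cases hsi : s < i
      · simp only [hs0, hsi, if_true, if_false]
        omega
      · by_cases hse : s = i
        · subst hse
          simp only [hs0, lt_irrefl, if_true, if_false, Nat.sub_self, pow_zero, Nat.div_one]
          simp only [Nat.sub_self, pow_zero, Nat.div_one] at hlt'
          omega
        · simp only [hs0, hsi, hse, if_false]
          omega
  have hDsum : ∑ s ∈ range (i + c), D s * (p : ℤ) ^ s = δ := by
    rw [Finset.sum_range_add]
    have e1 : ∑ s ∈ range i, D s * (p : ℤ) ^ s = y - m := by
      have e3 := sum_range_digit p y i
      rw [Nat.mod_eq_of_lt hylt] at e3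
      rw [← hmN]
      conv_rhs => rw [← e3]
      rw [Nat.cast_sum, Nat.cast_sum, ← sum_sub_distrib]
      refine sum_congr rfl fun s hs => ?_
      simp only [D, mem_range.1 hs, if_true]
      push_cast
      ring
    have e2 : ∑ s ∈ range c, D (i + s) * (p : ℤ) ^ (i + s) = b * (p : ℤ) ^ i := by
      rw [Finset.sum_eq_single 0]
      · simp [D]
      · intro s _ hs
        simp [D, hs]
      · intro h0
        exact absurd (mem_range.2 hc) h0
    rw [e1, e2, hy]
    ring
  have hEsum : ∑ s ∈ range (i + c), (E s : ℤ) * (p : ℤ) ^ s = m - k + (p : ℤ) ^ i * Z := by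
    rw [Finset.sum_range_add]
    have e1 : ∑ s ∈ range i, (E s : ℤ) * (p : ℤ) ^ s = m - k := by
      have e3 : ∀ s ∈ range i, (E s : ℤ) * (p : ℤ) ^ s =
          (h : ℤ) * (p : ℤ) ^ s - if s = 0 then k else 0 := by
        intro s hs
        simp only [E]
        by_cases hs0 : s = 0
        · subst hs0
          simp only [if_true, pow_zero, mul_one]
          omega
        · simp [hs0, mem_range.1 hs]
      rw [sum_congr rfl e3, sum_sub_distrib, sum_ite_eq', if_pos (mem_range.2 hi), ← hmN]
      push_cast
      rfl
    have e2 : ∑ s ∈ range c, (E (i + s) : ℤ) * (p : ℤ) ^ (i + s) = (p : ℤ) ^ i * Z := by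
      have e3 := sum_range_digit p Z c
      rw [Nat.mod_eq_of_lt hZlt] at e3
      conv_rhs => rw [← e3]
      rw [Nat.cast_sum, Finset.mul_sum]
      refine sum_congr rfl fun s _ => ?_
      have : i + s ≠ 0 := by omega
      simp only [E, this, if_false, show ¬ i + s < i by omega, Nat.add_sub_cancel_left]
      push_cast
      ring
    rw [e1, e2]
  refine not_weightCondition_of_digits hp0 D E (fun s hs => (hEb s hs).1)
    (fun s hs => (hEb s hs).2) ?_ ?_
  · by_contra! hall
    have : δ = 0 := by
      rw [← hDsum]
      exact Finset.sum_eq_zero fun s hs => by rw [hall s (mem_range.1 hs), zero_mul]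
    exact h5 (by rw [this, mul_zero]; exact dvd_zero _)
  · rw [hDsum, hEsum, hZ]
    refine ⟨m + k, ?_⟩
    rw [pow_add]
    linear_combination -hm

/-- In the application A, x, H are a, δ, h modulo p, so H = -1/2; the alternatives are the
obstructions to the multipliers δ, δ + 1, δ - 1, and their combinations force 2, 3, 5 or A to
vanish. -/
theorem false_of_three_multipliers {F : Type*} [Field F] {A x H : F} (h2 : (2 : F) ≠ 0)
    (h3 : (3 : F) ≠ 0) (h5 : (5 : F) ≠ 0) (hA : A ≠ 0) (hH : 2 * H + 1 = 0)
    (h : A * x = 0 ∨ A * x - 1 = 0)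
    (h' : A * (x + 1) = 0 ∨ A * (x + 1) - 1 = 0 ∨ x + 1 - H = 0 ∨ x + 1 + H = 0)
    (h'' : A * (x - 1) = 0 ∨ A * (x - 1) - 1 = 0 ∨ x - 1 - H = 0 ∨ x - 1 + H = 0) : False := by
  rcases h with h | h <;> rcases h' with h' | h' | h' | h' <;> rcases h'' with h'' | h'' | h'' | h''
  all_goals grind

/-- If 3a < p^c, a middle digit suffices. Otherwise a p^i exceeds a third of p^(i+c) + 1, which
keeps the multipliers in range, and one of three consecutive ones must work. -/
theorem not_weightCondition_mul_pow {p i c a : ℕ} (hp : p.Prime) (hp5 : 5 < p) (hi : 0 < i)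
    (hc : 0 < c) (ha : ¬ p ∣ a) (hac : a < p ^ c) :
    ¬ WeightCondition p (i + c) ((a : ℤ) * (p : ℤ) ^ i) := by
  obtain ⟨h, hph⟩ : ∃ h, p = 2 * h + 1 := hp.odd_of_ne_two (by omega)
  have hh : 3 ≤ h := by omega
  rcases Nat.lt_or_ge (3 * a) (p ^ c) with hsmall | hlarge
  · obtain ⟨g, r, hg, hr, hN, h0, h1, h2, h3⟩ := exists_middle_digit hp hp5 ha hsmall
    exact not_weightCondition_of_middle_digit hph hi (by omega) hr hN h0 h1 h2 h3
  have hlarge' : p ^ c + 1 ≤ 3 * a := by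
    rcases hlarge.lt_or_eq with hlt | heq
    · omega
    · exfalso
      have h3 : 3 ∣ p ^ c := ⟨a, heq⟩
      have := (Nat.prime_dvd_prime_iff_eq Nat.prime_three hp).1 (Nat.prime_three.dvd_of_dvd_pow h3)
      omega
  have hpz : (p : ℤ) = 2 * h + 1 := by exact_mod_cast hph
  obtain ⟨m, hm⟩ : ∃ m : ℤ, 2 * m + 1 = (p : ℤ) ^ i :=
    ⟨((∑ s ∈ range i, h * p ^ s : ℕ) : ℤ), by
      exact_mod_cast two_mul_sum_half_pow_add_one hph i⟩
  have hpi : (p : ℤ) ≤ (p : ℤ) ^ i := le_self_pow₀ (by omega) (by omega)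
  have hm3 : 3 ≤ m := by omega
  set Q : ℤ := (p : ℤ) ^ (i + c) with hQ
  set M : ℤ := a * (p : ℤ) ^ i with hM
  have hQM : Q = (p : ℤ) ^ i * (p : ℤ) ^ c := by rw [hQ, pow_add]
  have hpi0 : 0 < (p : ℤ) ^ i := by omega
  have hM0 : 0 < M := by
    have : (0 : ℤ) < a := by
      have : a ≠ 0 := by rintro rfl; exact ha (dvd_zero _)
      omega
    positivity
  have hMQ : M + 1 ≤ Q := by
    have h1 : (a : ℤ) + 1 ≤ (p : ℤ) ^ c := by exact_mod_cast hac
    nlinarith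
  have h3M : Q + 1 ≤ 3 * M := by
    have h1 : (p : ℤ) ^ c + 1 ≤ 3 * a := by exact_mod_cast hlarge'
    nlinarith
  -- The least multiplier with quotient at least m, a ceiling. Since M < Q + 1, its neighbours have
  -- quotient between m - 1 and m + 1, whence |k| ≤ 1.
  obtain ⟨δ, hδ1, hδ2⟩ : ∃ δ : ℤ, m * (Q + 1) ≤ M * δ ∧ M * δ < m * (Q + 1) + M := by
    refine ⟨(m * (Q + 1) + (M - 1)) / M, ?_, ?_⟩
    · have := Int.emod_lt_of_pos (m * (Q + 1) + (M - 1)) hM0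
      have := Int.mul_ediv_add_emod (m * (Q + 1) + (M - 1)) M
      omega
    · have := Int.emod_nonneg (m * (Q + 1) + (M - 1)) hM0.ne'
      have := Int.mul_ediv_add_emod (m * (Q + 1) + (M - 1)) M
      omega
  have hlow : m + 1 ≤ δ := by
    by_contra hcon
    have : M * δ ≤ M * m := mul_le_mul_of_nonneg_left (by omega) hM0.le
    nlinarith
  have hup : δ ≤ 3 * m := by
    by_contra hcon
    have : M * (3 * m + 1) ≤ M * δ := mul_le_mul_of_nonneg_left (by omega) hM0.le
    nlinarith
  have hgood := fun (δ k : ℤ) => not_weightCondition_of_multiplier (a := a) (δ := δ) (k := k) hph hh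
    hi hc hm
  rw [← hQ, ← hM] at hgood
  by_contra hW
  -- the three multipliers `δ - 1`, `δ` and `δ + 1`
  have hA : (p : ℤ) ∣ a * δ ∨ (p : ℤ) ∣ a * δ - 1 := by
    by_contra! hcon
    exact hgood δ 0 (by simp) (by linarith) (by linarith) (by omega) (by omega) hcon.1 hcon.2
      (Or.inl rfl) hW
  have hB : (p : ℤ) ∣ a * (δ + 1) ∨ (p : ℤ) ∣ a * (δ + 1) - 1 ∨ (p : ℤ) ∣ δ + 1 - h ∨
      (p : ℤ) ∣ δ + 1 + h := by
    by_contra! hcon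
    rcases lt_or_ge (M * (δ + 1)) ((m + 1) * (Q + 1)) with hlt | hge
    · exact hgood (δ + 1) 0 (by simp) (by linarith) (by linarith) (by omega) (by omega) hcon.1
        hcon.2.1 (Or.inl rfl) hW
    · exact hgood (δ + 1) 1 (by simp) (by linarith) (by linarith) (by omega) (by omega) hcon.1
        hcon.2.1 (Or.inr hcon.2.2) hW
  have hC : (p : ℤ) ∣ a * (δ - 1) ∨ (p : ℤ) ∣ a * (δ - 1) - 1 ∨ (p : ℤ) ∣ δ - 1 - h ∨
      (p : ℤ) ∣ δ - 1 + h := by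
    by_contra! hcon
    exact hgood (δ - 1) (-1) (by simp) (by linarith) (by linarith) (by omega) (by omega) hcon.1
      hcon.2.1 (Or.inr hcon.2.2) hW
  have : Fact p.Prime := ⟨hp⟩
  simp only [← ZMod.intCast_zmod_eq_zero_iff_dvd] at hA hB hC
  push_cast at hA hB hC
  have hne : ∀ n : ℕ, 0 < n → n < p → (n : ZMod p) ≠ 0 := fun n hn hlt h0 =>
    Nat.not_dvd_of_pos_of_lt hn hlt ((ZMod.natCast_eq_zero_iff n p).1 h0)
  refine false_of_three_multipliers (F := ZMod p) (A := a) (x := δ) (H := h)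
    (by exact_mod_cast hne 2 (by omega) (by omega)) (by exact_mod_cast hne 3 (by omega) (by omega))
    (by exact_mod_cast hne 5 (by omega) (by omega))
    (fun h0 => ha ((ZMod.natCast_eq_zero_iff a p).1 h0)) ?_ hA hB hC
  have h0 : ((2 * h + 1 : ℕ) : ZMod p) = 0 := (ZMod.natCast_eq_zero_iff _ _).2 ⟨1, by omega⟩
  exact_mod_cast h0

/-- If the last digit of κ is neither 0 nor 1, the multiplier 1 already satisfies the digit
criterion. Last digit 1 becomes 0 under κ ↦ p^n + 1 - κ, and digit 0 is the case a p^i. -/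
theorem not_weightCondition_of_le {p n κ : ℕ} (hp : p.Prime) (hp5 : 5 < p) (hκ : 2 ≤ κ)
    (hκn : 2 * κ ≤ p ^ n + 1) : ¬ WeightCondition p n κ := by
  have hn : 0 < n := by
    rcases Nat.eq_zero_or_pos n with rfl | h
    · simp at hκn; omega
    · exact h
  have hpn : p ∣ p ^ n := dvd_pow_self p hn.ne'
  have hdiv : ∀ κ : ℕ, 0 < κ → κ < p ^ n → p ∣ κ → ¬ WeightCondition p n κ := by
    intro κ h0 hlt hd
    obtain ⟨i, a, ha, rfl⟩ := Nat.exists_eq_pow_mul_and_not_dvd h0.ne' p hp.ne_one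
    have hi : 0 < i := by
      rcases Nat.eq_zero_or_pos i with rfl | h
      · simp at hd; exact absurd hd ha
      · exact h
    have ha0 : 0 < a := Nat.pos_of_mul_pos_left h0
    have hin : i < n := by
      rw [← Nat.pow_lt_pow_iff_right hp.one_lt]
      exact lt_of_le_of_lt (Nat.le_mul_of_pos_right _ ha0) hlt
    obtain ⟨c, rfl⟩ : ∃ c, n = i + c := ⟨n - i, by omega⟩
    rw [pow_add] at hlt
    have hac : a < p ^ c := lt_of_mul_lt_mul_left hlt (Nat.zero_le _)
    have := not_weightCondition_mul_pow hp hp5 hi (by omega) ha hac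
    rwa [show ((p ^ i * a : ℕ) : ℤ) = a * (p : ℤ) ^ i by push_cast; ring]
  have hlt : κ < p ^ n := by omega
  by_cases h0 : p ∣ κ
  · exact hdiv κ (by omega) hlt h0
  by_cases h1 : p ∣ κ - 1
  · intro hW
    refine hdiv (p ^ n + 1 - κ) (by omega) (by omega) ?_ (hW.neg.congr ⟨-1, ?_⟩)
    · rw [show p ^ n + 1 - κ = p ^ n - (κ - 1) by omega]
      exact Nat.dvd_sub hpn h1
    · rw [Nat.cast_sub (by omega)]
      push_cast
      ring
  · refine not_weightCondition_of_digits hp.pos (fun s => if s = 0 then 1 else 0)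
      (fun s => (κ - 1) / p ^ s % p) ?_ ?_ ⟨0, hn, by simp⟩ ?_
    · intro s _
      by_cases hs : s = 0
      · subst hs
        simp only [if_true, pow_zero, Nat.div_one]
        rw [Nat.dvd_iff_mod_eq_zero] at h1
        change 1 ≤ _
        omega
      · simp [hs]
    · intro s _
      have := Nat.mod_lt ((κ - 1) / p ^ s) hp.pos
      by_cases hs : s = 0
      · subst hs
        simp only [if_true, pow_zero, Nat.div_one] at this ⊢
        have h2 : (κ - 1) % p ≠ p - 1 := by
          intro h3
          have h4 := Nat.div_add_mod (κ - 1) p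
          exact h0 ⟨(κ - 1) / p + 1, by rw [mul_add, mul_one]; omega⟩
        change _ + 1 ≤ _
        omega
      · simp only [hs, if_false, Int.natAbs_zero]
        omega
    · have e1 : ∑ s ∈ range n, (if s = 0 then (1 : ℤ) else 0) * (p : ℤ) ^ s = 1 := by
        simp [ite_mul, hn]
      have e2 : ∑ s ∈ range n, (((κ - 1) / p ^ s % p : ℕ) : ℤ) * (p : ℤ) ^ s = κ - 1 := by
        have := sum_range_digit p (κ - 1) n
        rw [Nat.mod_eq_of_lt (by omega)] at this
        rw [show (κ : ℤ) - 1 = ((κ - 1 : ℕ) : ℤ) by omega]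
        conv_rhs => rw [← this]
        rw [Nat.cast_sum]
        exact sum_congr rfl fun s _ => by rw [Nat.cast_mul, Nat.cast_pow]
      rw [e1, e2]
      simp

/-- The weight condition determines `κ` up to sign. -/
theorem WeightCondition.dvd {p n : ℕ} {κ : ℤ} (hp : p.Prime) (hp5 : 5 < p)
    (h : WeightCondition p n κ) : (p : ℤ) ^ n + 1 ∣ κ ∨ (p : ℤ) ^ n + 1 ∣ κ - 1 ∨
      (p : ℤ) ^ n + 1 ∣ κ + 1 := by
  have hQ : 0 < (p : ℤ) ^ n + 1 := by positivity
  have hkey : ∀ r : ℤ, 0 ≤ r → 2 * r ≤ (p : ℤ) ^ n + 1 → WeightCondition p n r → r = 0 ∨ r = 1 := by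
    intro r hr0 hr hW
    lift r to ℕ using hr0
    by_contra! hcon
    exact not_weightCondition_of_le hp hp5 (by omega) (by exact_mod_cast hr) hW
  set r := κ % ((p : ℤ) ^ n + 1) with hr
  have hdr : (p : ℤ) ^ n + 1 ∣ κ - r := Int.dvd_self_sub_emod
  have hr0 := Int.emod_nonneg κ hQ.ne'
  have hr1 := Int.emod_lt_of_pos κ hQ
  rcases le_or_gt (2 * r) ((p : ℤ) ^ n + 1) with hle | hgt
  · rcases hkey r hr0 hle (h.congr hdr) with h0 | h0
    · left; simpa [h0] using hdr
    · right; left; simpa [h0] using hdr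
  · have hd : (p : ℤ) ^ n + 1 ∣ -κ - ((p : ℤ) ^ n + 1 - r) := by
      have := dvd_sub (dvd_neg.2 hdr) (dvd_refl ((p : ℤ) ^ n + 1))
      rwa [show -(κ - r) - ((p : ℤ) ^ n + 1) = -κ - ((p : ℤ) ^ n + 1 - r) by ring] at this
    rcases hkey _ (by omega) (by omega) (h.neg.congr hd) with h0 | h0
    · rw [h0] at hd
      left; simpa using hd
    · rw [h0] at hd
      right; right
      have := dvd_neg.2 hd
      rwa [show -(-κ - 1) = κ + 1 by ring] at this

end WeightCondition

/-! ### Elementary properties of planar monomials -/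

section Planar

variable {K : Type*} [Field K] {d : ℕ}

theorem IsPlanarFunction.even_of_pow (hF : IsPlanarFunction fun x : K => x ^ d) : Even d := by
  by_contra hodd
  rw [Nat.not_even_iff_odd] at hodd
  -- For odd d the difference map with α = 1 vanishes at both 0 and -1.
  have h := (hF 1 one_ne_zero).1 (a₁ := 0) (a₂ := -1)
    (by simp [hodd.neg_one_pow, zero_pow hodd.pos.ne'])
  simp at h

theorem IsPlanarFunction.pos_of_pow (hF : IsPlanarFunction fun x : K => x ^ d) : 0 < d := by
  rcases Nat.eq_zero_or_pos d with rfl | h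
  · exact absurd ((hF 1 one_ne_zero).1 (a₁ := 0) (a₂ := 1) (by simp)) zero_ne_one
  · exact h

/-- With α = x - y and d even, the difference map takes the same value at y and at -x. -/
theorem IsPlanarFunction.eq_or_eq_neg_of_pow_eq (hF : IsPlanarFunction fun x : K => x ^ d) {x y : K}
    (hxy : x ^ d = y ^ d) : x = y ∨ x = -y := by
  by_cases h : x = y
  · exact Or.inl h
  right
  have hα : x - y ≠ 0 := sub_ne_zero.2 h
  have he := hF.even_of_pow
  have := (hF _ hα).1 (a₁ := y) (a₂ := -x) (by
    have h1 : -x + (x - y) = -y := by ring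
    simp [h1, he.neg_pow, hxy])
  rw [this, neg_neg]

theorem IsPlanarFunction.of_ringHom {L : Type*} [Field L] [Finite L] (φ : L →+* K)
    (hF : IsPlanarFunction fun x : K => x ^ d) : IsPlanarFunction fun x : L => x ^ d := by
  intro α hα
  rw [← Finite.injective_iff_bijective]
  intro x y hxy
  apply φ.injective
  apply (hF (φ α) ((map_ne_zero φ).2 hα)).1
  simpa using congrArg φ hxy

end Planar

theorem exists_ringHom_galoisField {K : Type*} [Field K] {p m N : ℕ} [hp : Fact p.Prime]
    (hK : Nat.card K = p ^ N) (hm : m ≠ 0) (hmN : m ∣ N) :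
    Nonempty (GaloisField p m →+* K) := by
  have hfinite : Finite K :=
    Nat.finite_of_card_ne_zero (by rw [hK]; exact pow_ne_zero _ hp.out.ne_zero)
  have := Fintype.ofFinite K
  have hK' : Fintype.card K = p ^ N := by rw [← Nat.card_eq_fintype_card, hK]
  have hchar : CharP K p := charP_of_card_eq_prime_pow (f := N) hK'
  let := ZMod.algebra K p
  have hfin : Module.finrank (ZMod p) K = N := by
    have h1 := Module.card_eq_pow_finrank (K := ZMod p) (V := K)
    rw [hK', ZMod.card] at h1
    exact (Nat.pow_right_injective hp.out.two_le h1).symm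
  obtain ⟨f⟩ := FiniteField.nonempty_algHom_of_finrank_dvd (F := ZMod p) (K := GaloisField p m)
    (L := K) (by rw [hfin, GaloisField.finrank p hm]; exact hmN)
  exact ⟨f.toRingHom⟩

theorem pow_eq_pow_of_modEq_card_sub_one {K : Type*} [Field K] [Fintype K] {a b : ℕ} (ha : 0 < a) (hb : 0 < b)
    (h : a ≡ b [MOD Fintype.card K - 1]) (x : K) : x ^ a = x ^ b := by
  by_cases hx : x = 0
  · rw [hx, zero_pow ha.ne', zero_pow hb.ne']
  · have h1 : ∀ m : ℕ, x ^ m = x ^ (m % (Fintype.card K - 1)) := by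
      intro m
      conv_lhs => rw [← Nat.div_add_mod m (Fintype.card K - 1), pow_add, pow_mul,
        FiniteField.pow_card_sub_one_eq_one x hx, one_pow, one_mul]
    rw [h1 a, h1 b, h]

/-! ### Prime fields -/

/-- The function `x ↦ x ^ ((p + 1) / 2)` is not planar over a field with `p > 5` elements. -/
theorem not_isPlanarFunction_half {K : Type*} [Field K] [Fintype K] {p h d : ℕ} (hp : p.Prime)
    (hp5 : 5 < p) (hK : Fintype.card K = p) (hph : p = 2 * h + 1)
    (hd : ∀ x : K, x ^ d = x * x ^ h) : ¬ IsPlanarFunction fun x : K => x ^ d := by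
  intro hF
  have hchar : CharP K p := by
    have : Fact p.Prime := ⟨hp⟩
    exact charP_of_card_eq_prime hK
  have hne : ∀ n : ℕ, 0 < n → n < p → (n : K) ≠ 0 := fun n hn hlt h0 =>
    Nat.not_dvd_of_pos_of_lt hn hlt ((CharP.cast_eq_zero_iff K p n).1 h0)
  have h2 : (2 : K) ≠ 0 := by exact_mod_cast hne 2 (by omega) (by omega)
  have h3 : (3 : K) ≠ 0 := by exact_mod_cast hne 3 (by omega) (by omega)
  have hsq : ∀ x : K, x ≠ 0 → x ^ h = 1 ∨ x ^ h = -1 := by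
    intro x hx
    have := FiniteField.pow_card_sub_one_eq_one x hx
    rw [hK, hph, Nat.add_sub_cancel, mul_comm, pow_mul] at this
    exact sq_eq_one_iff.1 this
  have hinj : ∀ x y : K, (x + 1) ^ d - x ^ d = (y + 1) ^ d - y ^ d → x = y := by
    intro x y hxy
    exact (hF 1 one_ne_zero).1 (by simpa using hxy)
  have h0 : (0 : K) ^ d = 0 := by rw [hd, zero_mul]
  have hneg : (-1 : K) ^ d = 1 := hF.even_of_pow.neg_one_pow
  have h4 : (4 : K) ^ d = 4 := by
    rw [hd, show (4 : K) = 2 ^ 2 by norm_num, ← pow_mul, mul_comm 2 h, pow_mul]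
    rcases hsq 2 h2 with h | h <;> rw [h] <;> norm_num
  -- Since x^d = ±x according to the quadratic character, the collision is 1, 0 if 2 is a square, 3,
  -- 0 if only 3 is, and 2, -1 if neither is.
  rcases hsq 2 h2 with e2 | e2
  · have := hinj 1 0 (by rw [one_add_one_eq_two, hd 2, e2, zero_add, h0, one_pow]; norm_num)
    exact one_ne_zero this
  rcases hsq 3 h3 with e3 | e3
  · have := hinj 3 0 (by
      rw [show (3 : K) + 1 = 4 by norm_num, h4, hd 3, e3, zero_add, h0, one_pow]; norm_num)
    exact h3 this
  · have := hinj 2 (-1) (by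
      rw [show (2 : K) + 1 = 3 by norm_num, hd 3, hd 2, e2, e3, neg_add_cancel, h0, hneg]
      norm_num)
    exact h3 (by linear_combination this)

/-- Planar monomials over prime fields. -/
theorem modEq_two_of_isPlanarFunction {K : Type*} [Field K] {p d : ℕ} (hp : p.Prime) (hp5 : 5 < p)
    (hK : Nat.card K = p) (hF : IsPlanarFunction fun x : K => x ^ d) : d ≡ 2 [MOD p - 1] := by
  have hd := hF.pos_of_pow
  obtain ⟨h, hph⟩ : ∃ h, p = 2 * h + 1 := hp.odd_of_ne_two (by omega)
  have hwt : ∀ e l : ℕ, 0 < e + l → 2 * (e + l) < p - 1 → ¬ p - 1 ∣ d * e + l := by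
    intro e l h0 hlt
    have := not_dvd_of_isPlanarFunction (N := 1) hp (by rw [hK, pow_one]) one_pos hd hF
      (IsSumPow.natural p e) (IsSumPow.natural p l) h0 (by omega)
    rwa [pow_one] at this
  set r := d % (p - 1) with hr
  have hrlt : r < p - 1 := Nat.mod_lt _ (by omega)
  have hdr : d = (p - 1) * (d / (p - 1)) + r := (Nat.div_add_mod d (p - 1)).symm
  have hreven : Even r := by
    have h1 : Even ((p - 1) * (d / (p - 1))) := by
      rw [show p - 1 = 2 * h by omega, mul_assoc]; exact even_two_mul _
    have h2 := hF.even_of_pow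
    rw [hdr, Nat.even_add] at h2
    exact h2.1 h1
  obtain ⟨r', hr'⟩ := hreven
  have hwt' : ∀ e l : ℕ, 0 < e + l → 2 * (e + l) < p - 1 → r * e + l ≠ p - 1 ∧ r * e + l ≠ 0 := by
    intro e l h0 hlt
    have h1 := hwt e l h0 hlt
    rw [hdr, add_mul, add_assoc, mul_assoc, Nat.dvd_add_right (dvd_mul_right _ _)] at h1
    exact ⟨fun h => h1 (h ▸ dvd_rfl), fun h => h1 (h ▸ dvd_zero _)⟩
  have hr0 : r ≠ 0 := fun h0 => (hwt' 1 0 (by omega) (by omega)).2 (by omega)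
  by_cases hr2 : r = 2
  · change d % (p - 1) = 2 % (p - 1)
    rw [← hr, hr2, Nat.mod_eq_of_lt (by omega)]
  exfalso
  rcases lt_trichotomy r (h + 1) with hlt | heq | hgt
  -- Here r ≥ 4 by parity. The quotient and remainder of p - 1 by r sum to less than (p - 1)/2,
  -- because e ≤ (p - 1)/4 and the remainder is small.
  · set e := (p - 1) / r with he
    have h1 := Nat.div_mul_le_self (p - 1) r
    have h2 := Nat.lt_div_mul_add (a := p - 1) (b := r) (by omega)
    rw [← he] at h1 h2
    have he2 : 2 ≤ e := (Nat.le_div_iff_mul_le (by omega)).2 (by omega)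
    have h3 : e * 4 ≤ e * r := Nat.mul_le_mul_left _ (by omega)
    have h4 : 2 * r ≤ e * r := Nat.mul_le_mul_right _ he2
    refine (hwt' e (p - 1 - e * r) (by omega) (by omega)).1 ?_
    rw [mul_comm r e]
    omega
  · have hfinite : Finite K := Nat.finite_of_card_ne_zero (by rw [hK]; exact hp.ne_zero)
    have := Fintype.ofFinite K
    have hK' : Fintype.card K = p := by rw [← Nat.card_eq_fintype_card, hK]
    refine not_isPlanarFunction_half hp hp5 hK' hph (fun x => ?_) hF
    rw [← pow_succ']
    refine pow_eq_pow_of_modEq_card_sub_one hd (by omega) ?_ x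
    rw [hK', ← heq]
    exact (Nat.mod_modEq d (p - 1)).symm
  · exact (hwt' 1 (p - 1 - r) (by omega) (by omega)).1 (by omega)

/-! ### Quadratic extensions and induction -/

/-- Passing from the exponents modulo `p ^ n - 1` to those modulo `p ^ (2 * n) - 1`. -/
theorem exists_modEq_of_isPlanarFunction {K : Type*} [Field K] {p n d f : ℕ} (hp : p.Prime)
    (hp5 : 5 < p) (hn : 0 < n) (hK : Nat.card K = p ^ (2 * n))
    (hF : IsPlanarFunction fun x : K => x ^ d) (hdf : d ≡ 2 * p ^ f [MOD p ^ n - 1]) :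
    ∃ i, d ≡ 2 * p ^ i [MOD p ^ (2 * n) - 1] := by
  have hd := hF.pos_of_pow
  have hone : 1 ≤ p ^ n := Nat.one_le_pow _ _ hp.pos
  have hone2 : 1 ≤ p ^ (2 * n) := Nat.one_le_pow _ _ hp.pos
  have hpn : p ≤ p ^ n := Nat.le_self_pow hn.ne' p
  have hcast1 : ((p ^ n - 1 : ℕ) : ℤ) = (p : ℤ) ^ n - 1 := by push_cast [hone]; rfl
  have hcast2 : ((p ^ (2 * n) - 1 : ℕ) : ℤ) = ((p : ℤ) ^ n) ^ 2 - 1 := by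
    push_cast [hone2]; ring
  -- a power of `p` inverse to `p ^ f`
  obtain ⟨g, v, hv⟩ : ∃ (g : ℕ) (v : ℤ),
      (p : ℤ) ^ f * (p : ℤ) ^ g = 1 + (((p : ℤ) ^ n) ^ 2 - 1) * v := by
    have h1 : ((p : ℤ) ^ n) ^ 2 - 1 ∣ (((p : ℤ) ^ n) ^ 2) ^ f - 1 := sub_one_dvd_pow_sub_one _ _
    obtain ⟨v, hv⟩ := h1
    refine ⟨2 * n * f - f, v, ?_⟩
    have h2 : f + (2 * n * f - f) = n * 2 * f := by
      have : f ≤ 2 * n * f := Nat.le_mul_of_pos_left _ (by omega)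
      rw [mul_comm n 2]
      omega
    rw [← pow_add, h2, pow_mul, pow_mul]
    linear_combination hv
  obtain ⟨w, hw⟩ := (Nat.modEq_iff_dvd.1 hdf.symm)
  rw [hcast1] at hw
  push_cast at hw
  -- the exponent `d * p ^ g` is `2` modulo `p ^ n - 1`
  set Q : ℤ := (p : ℤ) ^ n with hQ
  have hdg : (d : ℤ) * (p : ℤ) ^ g = 2 + (Q - 1) * (2 * (Q + 1) * v + w * (p : ℤ) ^ g) := by
    linear_combination (p : ℤ) ^ g * hw + 2 * hv
  set t : ℤ := 2 * (Q + 1) * v + w * (p : ℤ) ^ g with ht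
  have hback : (d : ℤ) = (p : ℤ) ^ f * (2 + (Q - 1) * t) - (Q ^ 2 - 1) * (d * v) := by
    linear_combination (p : ℤ) ^ f * hdg - (d : ℤ) * hv
  have hW : WeightCondition p n (1 - t) := by
    intro c₁ c₂ e l he hl h0 hlt hdvd
    refine not_dvd_of_isPlanarFunction hp hK (by omega) hd hF (he.pow_mul g) hl h0
      (by rw [mul_assoc]; omega) ?_
    rw [← Int.natCast_dvd_natCast, hcast2]
    push_cast
    convert hdvd using 1
    linear_combination (e : ℤ) * hdg
  have hmod : ∀ i : ℕ, Q ^ 2 - 1 ∣ (d : ℤ) - 2 * (p : ℤ) ^ i →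
      d ≡ 2 * p ^ i [MOD p ^ (2 * n) - 1] := by
    intro i hi
    refine (Nat.modEq_iff_dvd.2 ?_).symm
    rw [hcast2]
    push_cast
    exact hi
  have hκ := hW.dvd hp hp5
  rw [← hQ] at hκ
  rcases hκ with ⟨z, hz⟩ | ⟨z, hz⟩ | ⟨z, hz⟩
  -- Here d p^g ≡ 1 + Q, so all powers of u^(Q-1), an element of order Q + 1 > 2, have d-th power 1,
  -- although only ±1 may.
  · exfalso
    have hfinite : Finite K :=
      Nat.finite_of_card_ne_zero (by rw [hK]; exact pow_ne_zero _ hp.ne_zero)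
    obtain ⟨u, hu⟩ := IsCyclic.exists_generator (α := Kˣ)
    have hord : orderOf u = p ^ (2 * n) - 1 := by
      rw [orderOf_eq_card_of_forall_mem_zpowers hu, Nat.card_units, hK]
    have h1 : (u ^ (p ^ n - 1)) ^ d = 1 := by
      rw [← pow_mul, ← orderOf_dvd_iff_pow_eq_one, hord, ← Int.natCast_dvd_natCast, hcast2,
        Nat.cast_mul, hcast1]
      refine ⟨(p : ℤ) ^ f * (1 - (Q - 1) * z) - (Q - 1) * (d * v), ?_⟩
      linear_combination (Q - 1) * hback - (p : ℤ) ^ f * (Q - 1) ^ 2 * hz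
    have h2 : ((u ^ (p ^ n - 1) : Kˣ) : K) ^ d = 1 ^ d := by
      rw [one_pow, ← Units.val_pow_eq_pow_val, h1, Units.val_one]
    have h3 : (u ^ (p ^ n - 1)) ^ 2 = 1 := by
      rw [Units.ext_iff, Units.val_pow_eq_pow_val, Units.val_one]
      rcases hF.eq_or_eq_neg_of_pow_eq h2 with h | h <;> rw [h] <;> norm_num
    rw [← pow_mul, ← orderOf_dvd_iff_pow_eq_one, hord] at h3
    have h4 := Nat.le_of_dvd (by omega) h3
    zify at h4
    rw [hcast1, hcast2] at h4
    have h5 : (6 : ℤ) ≤ Q := by rw [hQ]; exact_mod_cast (by omega : 6 ≤ p ^ n)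
    nlinarith
  · refine ⟨f, hmod f ⟨-(p : ℤ) ^ f * z - d * v, ?_⟩⟩
    linear_combination hback - (p : ℤ) ^ f * (Q - 1) * hz
  -- Here d p^g ≡ 2Q, which adds n to the Frobenius exponent.
  · refine ⟨n + f, hmod (n + f) ⟨-(p : ℤ) ^ f * z - d * v, ?_⟩⟩
    rw [pow_add, ← hQ]
    linear_combination hback - (p : ℤ) ^ f * (Q - 1) * hz

theorem exists_modEq_of_isPlanarFunction_galoisField {p d : ℕ} [hp : Fact p.Prime] (hp5 : 5 < p)
    (k : ℕ) (hF : IsPlanarFunction fun x : GaloisField p (2 ^ k) => x ^ d) :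
    ∃ i, d ≡ 2 * p ^ i [MOD p ^ 2 ^ k - 1] := by
  induction k with
  | zero =>
    refine ⟨0, ?_⟩
    have hcard : Nat.card (GaloisField p (2 ^ 0)) = p := by
      rw [GaloisField.card p _ (by norm_num)]; simp
    simpa using modEq_two_of_isPlanarFunction hp.out hp5 hcard hF
  | succ k ih =>
    have hcard : Nat.card (GaloisField p (2 ^ (k + 1))) = p ^ 2 ^ (k + 1) :=
      GaloisField.card p _ (by positivity)
    obtain ⟨φ⟩ := exists_ringHom_galoisField (m := 2 ^ k) hcard (by positivity)
      (pow_dvd_pow 2 (Nat.le_succ k))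
    obtain ⟨f, hf⟩ := ih (hF.of_ringHom φ)
    rw [pow_succ' 2 k]
    replace hcard : Nat.card (GaloisField p (2 ^ (k + 1))) = p ^ (2 * 2 ^ k) := by
      rw [hcard, pow_succ']
    exact exists_modEq_of_isPlanarFunction hp.out hp5 (by positivity) hcard hF hf

/-! ### Converse and conclusion -/

theorem isPlanarFunction_pow_of_modEq {K : Type*} [Field K] {p N d i : ℕ} (hp : p.Prime)
    (hp5 : 5 < p) (hN : 0 < N) (hK : Nat.card K = p ^ N) (hd : d ≡ 2 * p ^ i [MOD p ^ N - 1]) :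
    IsPlanarFunction fun x : K => x ^ d := by
  have : Fact p.Prime := ⟨hp⟩
  have hfinite : Finite K := Nat.finite_of_card_ne_zero (by rw [hK]; exact pow_ne_zero _ hp.ne_zero)
  have := Fintype.ofFinite K
  have hK' : Fintype.card K = p ^ N := by rw [← Nat.card_eq_fintype_card, hK]
  have hchar : CharP K p := charP_of_card_eq_prime_pow (f := N) hK'
  have hpN : p ≤ p ^ N := Nat.le_self_pow hN.ne' p
  -- The exponent 0 is excluded since p^N - 1 > 2 is prime to p; reducing exponents modulo p^N - 1
  -- is valid at x = 0 only for positive ones.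
  have hd0 : 0 < d := by
    rcases Nat.eq_zero_or_pos d with rfl | h
    · exfalso
      have h1 : p ^ N - 1 ∣ 2 * p ^ i := (Nat.modEq_zero_iff_dvd).1 hd.symm
      have h2 : Nat.Coprime (p ^ N - 1) (p ^ i) := by
        refine Nat.Coprime.pow_right _ (Nat.coprime_comm.1 (hp.coprime_iff_not_dvd.2 ?_))
        intro h3
        have h4 := (Nat.dvd_sub (dvd_pow_self p hN.ne') h3)
        rw [Nat.sub_sub_self (by omega)] at h4
        exact hp.one_lt.ne' (Nat.dvd_one.1 h4)
      have h3 := Nat.le_of_dvd (by norm_num) (h2.dvd_of_dvd_mul_right h1)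
      omega
    · exact h
  have hpow : ∀ x : K, x ^ d = (x ^ p ^ i) ^ 2 := by
    intro x
    rw [← pow_mul, mul_comm]
    exact pow_eq_pow_of_modEq_card_sub_one hd0 (by have := Nat.pow_pos (n := i) hp.pos; omega)
      (by rw [hK']; exact hd) x
  have h2 : (2 : K) ≠ 0 := by
    intro h0
    have h3 : p ∣ 2 := (CharP.cast_eq_zero_iff K p 2).1 (by exact_mod_cast h0)
    have := Nat.le_of_dvd (by norm_num) h3
    omega
  intro α hα
  rw [← Finite.injective_iff_bijective]
  intro x y hxy
  simp only [hpow, add_pow_char_pow] at hxy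
  have h3 : x ^ p ^ i = y ^ p ^ i := by
    have h4 : 2 * α ^ p ^ i * (x ^ p ^ i - y ^ p ^ i) = 0 := by linear_combination hxy
    rcases mul_eq_zero.1 h4 with h5 | h5
    · exact absurd h5 (mul_ne_zero h2 (pow_ne_zero _ hα))
    · exact sub_eq_zero.1 h5
  exact iterateFrobenius_inj K p i (by simpa [iterateFrobenius_def] using h3)

theorem theorem2 {K : Type*} [Field K] (p k : ℕ) (hp : p.Prime) (hp5 : 5 < p)
    (hK : Nat.card K = p ^ (2 ^ k)) (d : ℕ) :
    IsPlanarPolynomial (Polynomial.X ^ d : Polynomial K) ↔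
      ∃ i : ℕ, d ≡ 2 * p ^ i [MOD (p ^ (2 ^ k) - 1)] := by
  have : Fact p.Prime := ⟨hp⟩
  have hiff : IsPlanarPolynomial (Polynomial.X ^ d : Polynomial K) ↔
      IsPlanarFunction fun x : K => x ^ d := by
    simp [IsPlanarPolynomial]
  rw [hiff]
  constructor
  · intro hF
    obtain ⟨φ⟩ := exists_ringHom_galoisField hK (m := 2 ^ k) (by positivity) dvd_rfl
    exact exists_modEq_of_isPlanarFunction_galoisField hp5 k (hF.of_ringHom φ)
  · rintro ⟨i, hi⟩
    exact isPlanarFunction_pow_of_modEq hp hp5 (by positivity) hK hi
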